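/- Theorem 1.4. Let $\mathcal M_1,\mathcal M_2$ be two matroids on the same $n$-element ground set $V$ and $w:V\to\mathbb Z$ an integer weight function. Let $W=\max_{e\in V}|w(e)|$ (with $W=0$ if $V=\emptyset$) and let $r$ be the maximum cardinality of a common independent set (read as $1$ if $\emptyset$ is the only common independent set). The weighted matroid intersection problem asks for a set $S$ that is independent in both matroids and maximizes $\sum_{e\in S}w(e)$. A parallel query algorithm knows $V$ and $w$, and accesses the matroids only through oracles, in rounds; in each round it may issue a number of queries to the oracles of $\mathcal M_1$ and $\mathcal M_2$ that is bounded by a fixed polynomial in $n$, and these queries may depend on the answers of earlier rounds only. An independence query asks of a set $X\subseteq V$ whether it is independent in $\mathcal M_i$; a rank query asks for the rank of $X$ in $\mathcal M_i$. Write $\log^+x=\max\{1,\log x\}$ for $x>0$ and $\log^+0=1$. There are deterministic parallel query algorithms which, on every such input, output an optimal solution of weighted matroid intersection, one using $$O\bigl(n^{1/3}r^{1/3}\log^+(Wr)\bigr)$$ rounds of rank queries, and one using $$O\bigl(n^{1/3}r^{1/2}\log^+(Wr)\,\log^+(n/r)\bigr)$$ rounds of independence queries. The implied constants and the polynomial are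 absolute, i.e. independent of $n$, $r$, $W$, $w$ and the matroids. -/

import Mathlib

/-- A deterministic adaptive algorithm with parallel access to an oracle. It either stops with an
output, or issues a round of `m` queries `q 0, …, q (m - 1)` simultaneously, and continues in a way
that depends on all the answers of that round. Here `Q`, `A`, `O` are the types of queries, answers
and outputs. -/
inductive ParallelAlg (Q A O : Type) : Type
  | done (out : O) : ParallelAlg Q A O
  | round (m : ℕ) (q : Fin m → Q) (next : (Fin m → A) → ParallelAlg Q A O) : ParallelAlg Q A O

namespace ParallelAlg

variable {Q A O : Type}

/-- The output of the algorithm when queries are answered by `oracle`. -/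
def output (oracle : Q → A) : ParallelAlg Q A O → O
  | done out => out
  | round _ q next => (next fun i => oracle (q i)).output oracle

/-- The number of rounds of queries made when queries are answered by `oracle`. -/
def rounds (oracle : Q → A) : ParallelAlg Q A O → ℕ
  | done _ => 0
  | round _ q next => (next fun i => oracle (q i)).rounds oracle + 1

/-- The largest number of queries made in a single round when queries are answered by `oracle`. -/
def width (oracle : Q → A) : ParallelAlg Q A O → ℕ
  | done _ => 0
  | round m q next => max m ((next fun i => oracle (q i)).width oracle)

end ParallelAlg

namespace MatroidIntersection

/-- A query is a subset of the ground set, addressed to the first matroid (`Sum.inl`) or to the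
second one (`Sum.inr`). -/
abbrev Query (n : ℕ) : Type := Finset (Fin n) ⊕ Finset (Fin n)

/-- A parallel algorithm with access to independence oracles of two matroids on `Fin n`, which
outputs a subset of `Fin n`. -/
abbrev IndepAlg (n : ℕ) : Type := ParallelAlg (Query n) Bool (Finset (Fin n))

/-- A parallel algorithm with access to rank oracles of two matroids on `Fin n`, which outputs a
subset of `Fin n`. -/
abbrev RankAlg (n : ℕ) : Type := ParallelAlg (Query n) ℕ (Finset (Fin n))

open Classical in
/-- The independence oracles of `M₁` and `M₂`. -/
noncomputable def indepOracle {n : ℕ} (M₁ M₂ : Matroid (Fin n)) : Query n → Bool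
  | Sum.inl S => decide (M₁.Indep (S : Set (Fin n)))
  | Sum.inr S => decide (M₂.Indep (S : Set (Fin n)))

/-- The rank oracles of `M₁` and `M₂` (all ranks are finite as `Fin n` is). -/
noncomputable def rankOracle {n : ℕ} (M₁ M₂ : Matroid (Fin n)) : Query n → ℕ
  | Sum.inl S => (M₁.eRk (S : Set (Fin n))).toNat
  | Sum.inr S => (M₂.eRk (S : Set (Fin n))).toNat

/-- `S` is independent in both matroids. -/
def CommonIndep {n : ℕ} (M₁ M₂ : Matroid (Fin n)) (S : Finset (Fin n)) : Prop :=
  M₁.Indep (S : Set (Fin n)) ∧ M₂.Indep (S : Set (Fin n))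

/-- `S` is a common independent set of maximum weight. -/
def IsMaxWeight {n : ℕ} (M₁ M₂ : Matroid (Fin n)) (w : Fin n → ℤ) (S : Finset (Fin n)) : Prop :=
  CommonIndep M₁ M₂ S ∧ ∀ T, CommonIndep M₁ M₂ T → ∑ e ∈ T, w e ≤ ∑ e ∈ S, w e

open Classical in
/-- The maximum cardinality of a common independent set. -/
noncomputable def commonRank {n : ℕ} (M₁ M₂ : Matroid (Fin n)) : ℕ :=
  (Finset.univ.filter fun S : Finset (Fin n) => CommonIndep M₁ M₂ S).sup Finset.card

/-- The largest absolute value of a weight (`0` if the ground set is empty). -/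
def maxAbsWeight {n : ℕ} (w : Fin n → ℤ) : ℕ := Finset.univ.sup fun e => (w e).natAbs

end MatroidIntersection

/-! Adding `k` free elements of weight `0` to both matroids and truncating to rank `k` turns common
independent sets of size at most `k` into common bases. A common base is certified by a weight
splitting: if it is a maximum base of `M₁` for `w₁` and of `M₂` for `w₂`, no common base has larger
`w₁ + w₂`. Bases have `k` elements, so after multiplying the weights by `k + 1` it is enough that
`w₁ + w₂` lies between `w` and `w + 1`.

Such a splitting is reached by scaling: a phase of precision `δ` inherits error `2 * δ` and leaves
error `δ`. It begins with an auction. Elements lying only in the first of the two greedy bases are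
raised simultaneously, alternately gaining `δ` in the second weight and losing `δ` in the first. By
monotonicity of greedy bases (`mem_greedyBase_of_le`) a raised element of the second base also lies
in the first. Comparison with the common base of the previous phase then bounds the total decrease
on the difference of the bases, so that, with at most `2 * d` raises per element, this difference
ends with at most `6 * k / d` elements (`AuctionInv.card_sdiff_le`). A round raising more than `k /
d` of the `N = n + k` elements can occur at most `2 * d ^ 2 * N / k` times.

The remaining difference is removed by weighted augmentations. The possible exchanges depend only on
the bases, not on the weights, so after one round of queries the splitting can be shifted until a
path of tight exchanges appears, and a shortest path followed, without further queries
(`exists_isAugmentation`, `IsAugmentation.valid`).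

If greedy bases cost `t` rounds, a phase costs about `d ^ 2 * N * t / k + k / d`; choosing `d ^ 3`
near `k ^ 2 / (N * t)` balances this at the cube root of `N * k * t`. Greedy bases are read off the
ranks of prefixes, so `t = 1` for rank queries. For independence queries the ranks come from a
parallel basis search by blocks of about `√k` elements, with `t` of order `√k * (1 + log (N / k))`.

As `r` is unknown, `k` is first doubled with unit weights. The cost bounds grow geometrically in
these runs, so they are dominated by the last one. The number of phases contributes the factor `log⁺
(W r)`. -/

set_option linter.unusedSectionVars false

/-! ### Composition and cost of parallel algorithms -/

namespace ParallelAlg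

variable {Q A O P S : Type}

/-- Sequential composition of parallel algorithms. -/
def bind : ParallelAlg Q A O → (O → ParallelAlg Q A P) → ParallelAlg Q A P
  | done x, f => f x
  | round m q next, f => round m q fun a => (next a).bind f

/-- Issue a family of queries in a single round and return all the answers. -/
noncomputable def ask {ι : Type} [Fintype ι] (q : ι → Q) : ParallelAlg Q A (ι → A) :=
  round (Fintype.card ι) (fun j => q ((Fintype.equivFin ι).symm j))
    fun a => done fun i => a (Fintype.equivFin ι i)

/-- Run `t` times the algorithm `f`, feeding it its own output. -/
def iter (f : S → ParallelAlg Q A S) : ℕ → S → ParallelAlg Q A S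
  | 0, s => done s
  | t + 1, s => (f s).bind (iter f t)

variable (o : Q → A)

@[simp] lemma output_done (x : O) : (done x : ParallelAlg Q A O).output o = x := by
  simp [output]

@[simp] lemma rounds_done (x : O) : (done x : ParallelAlg Q A O).rounds o = 0 := by
  simp [rounds]

@[simp] lemma width_done (x : O) : (done x : ParallelAlg Q A O).width o = 0 := by
  simp [width]

@[simp] lemma output_bind (a : ParallelAlg Q A O) (f : O → ParallelAlg Q A P) :
    (a.bind f).output o = (f (a.output o)).output o := by
  induction a with
  | done x => simp [bind, output]
  | round m q next ih => simp [bind, output, ih]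

@[simp] lemma rounds_bind (a : ParallelAlg Q A O) (f : O → ParallelAlg Q A P) :
    (a.bind f).rounds o = a.rounds o + (f (a.output o)).rounds o := by
  induction a with
  | done x => simp [bind, output, rounds]
  | round m q next ih => simp [bind, output, rounds, ih]; ring

@[simp] lemma width_bind (a : ParallelAlg Q A O) (f : O → ParallelAlg Q A P) :
    (a.bind f).width o = max (a.width o) ((f (a.output o)).width o) := by
  induction a with
  | done x => simp [bind, output, width]
  | round m q next ih => simp [bind, output, width, ih, max_assoc]

@[simp] lemma output_ask {ι : Type} [Fintype ι] (q : ι → Q) :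
    (ask q : ParallelAlg Q A _).output o = fun i => o (q i) := by
  simp [ask, output]

@[simp] lemma rounds_ask {ι : Type} [Fintype ι] (q : ι → Q) :
    (ask q : ParallelAlg Q A _).rounds o = 1 := by
  simp [ask, rounds]

@[simp] lemma width_ask {ι : Type} [Fintype ι] (q : ι → Q) :
    (ask q : ParallelAlg Q A _).width o = Fintype.card ι := by
  simp [ask, width]

lemma output_iter (f : S → ParallelAlg Q A S) (t : ℕ) (s : S) :
    (iter f t s).output o = (fun s => (f s).output o)^[t] s := by
  induction t generalizing s with
  | zero => simp [iter]
  | succ t ih => simp [iter, ih]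

lemma rounds_iter_le {f : S → ParallelAlg Q A S} {c : ℕ} (h : ∀ s, (f s).rounds o ≤ c)
    (t : ℕ) (s : S) : (iter f t s).rounds o ≤ t * c := by
  induction t generalizing s with
  | zero => simp [iter]
  | succ t ih =>
    simp only [iter, rounds_bind]
    have := h s
    have := ih ((f s).output o)
    linarith [Nat.succ_mul t c]

lemma width_iter_le {f : S → ParallelAlg Q A S} {c : ℕ} (h : ∀ s, (f s).width o ≤ c)
    (t : ℕ) (s : S) : (iter f t s).width o ≤ c := by
  induction t generalizing s with
  | zero => simp [iter]
  | succ t ih =>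
    simp only [iter, width_bind]
    exact max_le (h s) (ih _)

end ParallelAlg

namespace MatroidIntersection

open Set

/-! ### Local optimality and simultaneous exchanges in one matroid -/

section Exchange

variable {α : Type} [Fintype α] [DecidableEq α] {M : Matroid α}

/-- The fundamental circuit of `b` in `S`, without `b`, spans `b`, whereas `T \ {b}` does not. Hence
some `a` of this circuit is outside `M.closure (T \ {b})`, and this `a` serves both bases. -/
lemma exists_symm_exchange (hE : M.E = univ) {S T : Set α} (hS : M.IsBase S) (hT : M.IsBase T)
    {b : α} (hbT : b ∈ T) (hbS : b ∉ S) :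
    ∃ a ∈ S \ T, b ∉ M.closure (S \ {a}) ∧ M.IsBase (insert a (T \ {b})) := by
  have hbE : b ∈ M.E := by simp [hE]
  have hC := hS.fundCircuit_isCircuit hbE hbS
  have hb1 : b ∉ M.closure (T \ {b}) := hT.indep.notMem_closure_sdiff_of_mem hbT
  have hb2 := hC.mem_closure_sdiff_singleton_of_mem (M.mem_fundCircuit b S)
  have : ¬ (M.fundCircuit b S \ {b} ⊆ M.closure (T \ {b})) := fun h =>
    hb1 (M.closure_subset_closure_of_subset_closure h hb2)
  obtain ⟨a, ⟨haC, hab⟩, haT⟩ := not_subset.1 this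
  have hab : a ≠ b := hab
  have haS : a ∈ S := by
    have := M.fundCircuit_subset_insert b S haC
    simpa [hab] using this
  have haT' : a ∉ T := fun h =>
    haT (M.mem_closure_of_mem' ⟨h, hab⟩ (by simp [hE]))
  refine ⟨a, ⟨haS, haT'⟩, ?_, hT.exchange_base_of_notMem_closure hbT haT (by simp [hE])⟩
  rw [hS.indep.mem_fundCircuit_iff (by rwa [hS.closure_eq]) hbS,
    ← insert_sdiff_singleton_comm hab.symm] at haC
  have := (Matroid.insert_indep_iff.1 haC).2 (fun h => hbS h.1)
  exact this.2

/-- A base none of whose single exchanges increases the weight. -/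
def IsLocalMax (M : Matroid α) (w : α → ℤ) (S : Finset α) : Prop :=
  M.IsBase (S : Set α) ∧ ∀ a ∈ S, ∀ b ∉ S, b ∉ M.closure ((S : Set α) \ {a}) → w b ≤ w a

/-- Symmetric exchange moves `T` one element closer to `S`, and local maximality says that the
exchanged pair does not decrease the weight of `T`. -/
lemma IsLocalMax.sum_le (hE : M.E = univ) {w : α → ℤ} {S : Finset α} (hS : IsLocalMax M w S)
    {T : Finset α} (hT : M.IsBase (T : Set α)) : ∑ e ∈ T, w e ≤ ∑ e ∈ S, w e := by
  induction h : (T \ S).card using Nat.strong_induction_on generalizing T with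
  | _ n ih =>
  by_cases hTS : T ⊆ S
  · have : (T : Set α) = S := hT.eq_of_subset_isBase hS.1 (by exact_mod_cast hTS)
    rw [Finset.coe_injective this]
  obtain ⟨b, hbT, hbS⟩ := Finset.not_subset.1 hTS
  obtain ⟨a, ⟨haS, haT⟩, h1, h2⟩ := exists_symm_exchange hE hS.1 hT hbT hbS
  have haS : a ∈ S := haS
  have haT : a ∉ T := haT
  have hw := hS.2 a haS b hbS h1
  have h3 := ih ((insert a (T.erase b)) \ S).card ?_ (T := insert a (T.erase b))
    (by simpa using h2) rfl
  · rw [Finset.sum_insert (by simp [haT])] at h3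
    have := Finset.add_sum_erase T w hbT
    linarith
  · rw [← h]
    apply Finset.card_lt_card
    refine ⟨fun x hx => ?_, fun hsub => ?_⟩
    · simp only [Finset.mem_sdiff, Finset.mem_insert, Finset.mem_erase] at hx ⊢
      rcases hx with ⟨rfl | ⟨-, h⟩, h'⟩
      · exact absurd haS h'
      · exact ⟨h, h'⟩
    · have := hsub (Finset.mem_sdiff.2 ⟨hbT, hbS⟩)
      simp only [Finset.mem_sdiff, Finset.mem_insert, Finset.mem_erase] at this
      rcases this.1 with rfl | ⟨h, -⟩
      · exact haT hbT
      · exact h rfl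

lemma isLocalMax_of_sum_le (hE : M.E = univ) {w : α → ℤ} {S : Finset α}
    (hS : M.IsBase (S : Set α))
    (h : ∀ T : Finset α, M.IsBase (T : Set α) → ∑ e ∈ T, w e ≤ ∑ e ∈ S, w e) :
    IsLocalMax M w S := by
  refine ⟨hS, fun a ha b hb hab => ?_⟩
  have h1 := hS.exchange_base_of_notMem_closure (by exact_mod_cast ha) hab (by simp [hE])
  have h2 := h (insert b (S.erase a)) (by simpa using h1)
  rw [Finset.sum_insert (by simp [hb])] at h2
  have := Finset.add_sum_erase S w ha
  linarith

/-- Closure commutes with intersections of subsets of an independent set. `S` itself is added to the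
family to keep it nonempty when `I` is empty. -/
lemma mem_closure_sdiff_image (hE : M.E = univ) {ι : Type} {S : Set α} (hS : M.IsBase S)
    (a : ι → α) (I : Set ι) {x : α} (h : ∀ j ∈ I, x ∈ M.closure (S \ {a j})) :
    x ∈ M.closure (S \ a '' I) := by
  have := hS.indep.closure_sInter_eq_biInter_closure_of_forall_subset
    (Js := insert S ((fun j => S \ {a j}) '' I)) ⟨S, mem_insert _ _⟩ (by
      rintro J (rfl | ⟨j, -, rfl⟩)
      · exact subset_rfl
      · exact sdiff_subset)
  have h2 : ⋂₀ (insert S ((fun j => S \ {a j}) '' I)) = S \ a '' I := by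
    ext y
    simp only [mem_sInter, mem_insert_iff, forall_eq_or_imp, mem_image, forall_exists_index,
      and_imp, forall_apply_eq_imp_iff₂, mem_sdiff, mem_singleton_iff, not_exists]
    constructor
    · rintro ⟨h1, h2⟩
      exact ⟨h1, fun j hj => (h2 j hj.1).2 hj.2.symm⟩
    · rintro ⟨h1, h2⟩
      exact ⟨h1, fun j hj => ⟨h1, fun he => h2 j ⟨hj, he.symm⟩⟩⟩
  rw [h2] at this
  rw [this]
  simp only [mem_insert_iff, mem_iInter]
  rintro J (rfl | ⟨j, hj, rfl⟩)
  · simp [hS.closure_eq, hE]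
  · exact h j hj

/-- A simultaneous exchange is valid when its exchange relation is triangular. -/
lemma closure_multi_exchange (hE : M.E = univ) {ι K : Type} [DecidableEq ι] [LinearOrder K]
    {S : Set α} (hS : M.IsBase S) (a b : ι → α) (f : ι → K) (I : Finset ι)
    (hab : ∀ i ∈ I, b i ∉ M.closure (S \ {a i}))
    (htri : ∀ i ∈ I, ∀ j ∈ I, j ≠ i → f j ≤ f i → b i ∈ M.closure (S \ {a j})) :
    M.closure (S \ a '' (I : Set ι) ∪ b '' (I : Set ι)) = univ := by
  induction I using Finset.induction_on_max_value f with
  | empty => simp [hS.closure_eq, hE]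
  | insert i I hiI hmax ih =>
    have ih := ih (fun j hj => hab j (Finset.mem_insert_of_mem hj))
      (fun j hj l hl => htri j (Finset.mem_insert_of_mem hj) l (Finset.mem_insert_of_mem hl))
    have hsub : ∀ X : Set α, X ⊆ M.E := fun X => by rw [hE]; exact subset_univ _
    set T' := S \ a '' (↑(insert i I) : Set ι) ∪ b '' (↑(insert i I) : Set ι) with hT'
    -- As `i` has the largest key, `b i` is spanned after removal of the earlier `a j`, but no
    -- longer once `a i` is removed too. The exchange property then puts `a i` back into the closure
    -- of the new set.
    have h1 : b i ∈ M.closure (S \ a '' (I : Set ι)) :=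
      mem_closure_sdiff_image hE hS a I fun j hj =>
        htri i (Finset.mem_insert_self _ _) j (Finset.mem_insert_of_mem hj)
          (fun h => hiI (h ▸ hj)) (hmax j hj)
    have h2 : b i ∉ M.closure (S \ a '' (↑(insert i I) : Set ι)) := fun h =>
      hab i (Finset.mem_insert_self _ _) (M.closure_subset_closure (sdiff_subset_sdiff_right
        (by rintro _ rfl; exact ⟨i, by simp, rfl⟩)) h)
    have h3 : b i ∈ M.closure (insert (a i) (S \ a '' (↑(insert i I) : Set ι))) := by
      refine M.closure_subset_closure (fun x hx => ?_) h1
      by_cases hx' : x = a i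
      · exact Or.inl hx'
      · refine Or.inr ⟨hx.1, ?_⟩
        rintro ⟨j, hj, rfl⟩
        rcases Finset.mem_insert.1 (Finset.mem_coe.1 hj) with rfl | hj
        · exact hx' rfl
        · exact hx.2 ⟨j, hj, rfl⟩
    have h4 : a i ∈ M.closure T' :=
      M.closure_subset_closure (by
        rintro x (rfl | hx)
        · exact Or.inr ⟨i, by simp, rfl⟩
        · exact Or.inl hx) (Matroid.mem_closure_insert h2 h3)
    have h5 : S \ a '' (I : Set ι) ∪ b '' (I : Set ι) ⊆ M.closure T' := by
      rintro x (hx | ⟨j, hj, rfl⟩)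
      · by_cases hx' : x = a i
        · exact hx' ▸ h4
        · refine M.mem_closure_of_mem' (Or.inl ⟨hx.1, ?_⟩) (by simp [hE])
          rintro ⟨j, hj, rfl⟩
          rcases Finset.mem_insert.1 (Finset.mem_coe.1 hj) with rfl | hj
          · exact hx' rfl
          · exact hx.2 ⟨j, hj, rfl⟩
      · exact M.mem_closure_of_mem' (Or.inr ⟨j, by simp [Finset.mem_coe.1 hj], rfl⟩) (by simp [hE])
    have := M.closure_subset_closure_of_subset_closure h5
    rw [ih] at this
    exact univ_subset_iff.1 this

lemma isBase_of_closure_eq_univ (hE : M.E = univ) {S T : Finset α} (hS : M.IsBase (S : Set α))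
    (hT : M.closure (T : Set α) = univ) (hc : T.card ≤ S.card) : M.IsBase (T : Set α) := by
  have hsp : M.Spanning (T : Set α) := by
    rw [Matroid.spanning_iff_closure_eq (by simp [hE]), hT, hE]
  obtain ⟨B, hB, hBT⟩ := hsp.exists_isBase_subset
  have h1 := hB.ncard_eq_ncard_of_isBase hS
  rw [ncard_coe_finset] at h1
  have : B = (T : Set α) := Set.eq_of_subset_of_ncard_le hBT
    (by rw [ncard_coe_finset, h1]; exact hc) (Finset.finite_toSet T)
  exact this ▸ hB

/-- Exchanging along tight pairs that are triangular keeps a local maximum. -/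
lemma IsLocalMax.multi_exchange (hE : M.E = univ) {w : α → ℤ} {S : Finset α}
    (hS : IsLocalMax M w S) (a b : ℕ → α) (I : Finset ℕ) (g : ℕ → ℤ) (hg : Function.Injective g)
    (ha : Set.InjOn a I) (hb : Set.InjOn b I) (haS : ∀ i ∈ I, a i ∈ S) (hbS : ∀ i ∈ I, b i ∉ S)
    (hw : ∀ i ∈ I, w (a i) = w (b i)) (hab : ∀ i ∈ I, b i ∉ M.closure ((S : Set α) \ {a i}))
    (htri : ∀ i ∈ I, ∀ j ∈ I, g j < g i → w (b i) = w (a j) →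
      b i ∈ M.closure ((S : Set α) \ {a j})) :
    IsLocalMax M w ((S \ I.image a) ∪ I.image b) := by
  -- With the weight as leading key, local maximality itself forbids exchanging `b i` for an `a j`
  -- of smaller weight; `htri` is only needed within one weight class.
  have hcl := closure_multi_exchange hE hS.1 a b (fun i => toLex (w (a i), g i)) I hab (by
    intro i hi j hj hji hle
    by_contra hcon
    have h1 := hS.2 _ (haS j hj) _ (hbS i hi) hcon
    rw [Prod.Lex.toLex_le_toLex] at hle
    rcases hle with h | ⟨h, h'⟩
    · exact absurd h (by rw [hw i hi]; exact not_lt.2 h1)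
    · exact hcon (htri i hi j hj (lt_of_le_of_ne h' (fun h => hji (hg h)))
        (by rw [← hw i hi]; exact h.symm)))
  have hsubA : I.image a ⊆ S := Finset.image_subset_iff.2 haS
  have hdisj : Disjoint (S \ I.image a) (I.image b) := by
    rw [Finset.disjoint_right]
    intro x hx
    obtain ⟨i, hi, rfl⟩ := Finset.mem_image.1 hx
    simp [hbS i hi]
  have hbase : M.IsBase (((S \ I.image a) ∪ I.image b : Finset α) : Set α) := by
    apply isBase_of_closure_eq_univ hE hS.1
    · push_cast
      exact hcl
    · rw [Finset.card_union_of_disjoint hdisj, Finset.card_sdiff_of_subset hsubA,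
        Finset.card_image_of_injOn ha, Finset.card_image_of_injOn hb]
      have := Finset.card_le_card hsubA
      rw [Finset.card_image_of_injOn ha] at this
      omega
  have hsum : ∑ e ∈ (S \ I.image a) ∪ I.image b, w e = ∑ e ∈ S, w e := by
    rw [Finset.sum_union hdisj, Finset.sum_image hb, ← Finset.sum_sdiff hsubA, Finset.sum_image ha,
      Finset.sum_congr rfl hw]
  exact isLocalMax_of_sum_le hE hbase fun T hT => hsum ▸ hS.sum_le hE hT

end Exchange

/-! ### Shortest paths -/

section Path

variable {α : Type} {r : α → α → Prop} {s t : α → Prop}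

/-- `v` visits a source first and a target last, in `m` steps of the relation `r`. -/
def IsPath (r : α → α → Prop) (s t : α → Prop) (m : ℕ) (v : ℕ → α) : Prop :=
  s (v 0) ∧ t (v m) ∧ ∀ i < m, r (v i) (v (i + 1))

lemma exists_isPath_of_reflTransGen {x y : α} (hx : s x) (h : Relation.ReflTransGen r x y) :
    ∃ m v, IsPath r s (· = y) m v := by
  induction h with
  | refl => exact ⟨0, fun _ => x, hx, rfl, by simp⟩
  | @tail y z _ hyz ih =>
    obtain ⟨m, v, h0, hm, hv⟩ := ih
    refine ⟨m + 1, fun i => if i ≤ m then v i else z, by simpa using h0, by simp, fun i hi => ?_⟩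
    have him : i ≤ m := by omega
    rcases him.lt_or_eq with h | rfl
    · have : i + 1 ≤ m := h
      simpa [him, this] using hv i h
    · simpa [hm] using hyz

/-- A path with as few steps as possible has no repetitions and no shortcuts. -/
lemma exists_isPath_minimal {m : ℕ} {v : ℕ → α} (h : IsPath r s t m v) :
    ∃ m v, IsPath r s t m v ∧ InjOn v (Set.Iic m) ∧
      ∀ i j, i + 1 < j → j ≤ m → ¬ r (v i) (v j) := by
  classical
  have hex : ∃ m, ∃ v, IsPath r s t m v := ⟨m, v, h⟩
  obtain ⟨v, hv⟩ := Nat.find_spec hex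
  have hmin : ∀ m' < Nat.find hex, ¬ ∃ v, IsPath r s t m' v := fun m' hm' => Nat.find_min hex hm'
  generalize Nat.find hex = n at hv hmin
  have hshort : ∀ i j, i + 1 < j → j ≤ n → ¬ r (v i) (v j) := by
    intro i j hij hjn hr
    refine hmin (n - (j - i - 1)) (by omega)
      ⟨fun l => if l ≤ i then v l else v (l + (j - i - 1)), ?_, ?_, ?_⟩
    · simpa using hv.1
    · have h1 : ¬ (n - (j - i - 1) ≤ i) := by omega
      have h2 : n - (j - i - 1) + (j - i - 1) = n := by omega
      simpa [h1, h2] using hv.2.1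
    · intro l hl
      rcases lt_trichotomy l i with h | rfl | h
      · have h1 : l + 1 ≤ i := h
        simpa [h.le, h1] using hv.2.2 l (by omega)
      · have h2 : l + 1 + (j - l - 1) = j := by omega
        simpa [h2] using hr
      · have h1 : ¬ (l ≤ i) := by omega
        have h2 : ¬ (l + 1 ≤ i) := by omega
        have h3 : l + 1 + (j - i - 1) = l + (j - i - 1) + 1 := by omega
        simpa [h1, h2, h3] using hv.2.2 (l + (j - i - 1)) (by omega)
  -- A repetition gives a shortcut from `i` to `j + 1` or, if `j` is the end, a shorter path ending
  -- at `i`.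
  have hne : ∀ i j, i < j → j ≤ n → v i ≠ v j := by
    intro i j hij hjn he
    rcases hjn.lt_or_eq with h | rfl
    · exact hshort i (j + 1) (by omega) h (he ▸ hv.2.2 j h)
    · exact hmin i hij ⟨v, hv.1, he ▸ hv.2.1, fun l hl => hv.2.2 l (by omega)⟩
  refine ⟨n, v, hv, fun i hi j hj he => ?_, hshort⟩
  rcases lt_trichotomy i j with h | h | h
  · exact absurd he (hne i j h hj)
  · exact h
  · exact absurd he.symm (hne j i h hi)

end Path

/-! ### Weight splittings and augmentation -/

/-- Two weight functions and, for each of them, a base of the corresponding matroid. -/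
structure Splitting (α : Type) where
  w₁ : α → ℤ
  w₂ : α → ℤ
  S₁ : Finset α
  S₂ : Finset α

namespace Splitting

variable {α : Type} [Fintype α] [DecidableEq α] {M₁ M₂ : Matroid α}

/-- Both bases are locally maximal. -/
def Valid (M₁ M₂ : Matroid α) (σ : Splitting α) : Prop :=
  IsLocalMax M₁ σ.w₁ σ.S₁ ∧ IsLocalMax M₂ σ.w₂ σ.S₂

/-- `x` can be replaced by `y` in the first base without a change of weight; here `R x y` says that
`x` may be replaced by `y`. -/
def Tight₁ (R : α → α → Prop) (S : Finset α) (w : α → ℤ) (x y : α) : Prop :=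
  x ∈ S ∧ y ∉ S ∧ R x y ∧ w x = w y

/-- `y` can be replaced by `x` in the second base without a change of weight. -/
def Tight₂ (R : α → α → Prop) (S : Finset α) (w : α → ℤ) (x y : α) : Prop :=
  Tight₁ R S w y x

/-- `τ` arises from `σ` by a change of the weight splitting that keeps both bases optimal,
followed by an exchange along a shortest path of tight exchanges. -/
structure IsAugmentation (R₁ R₂ : α → α → Prop) (σ τ : Splitting α) (m : ℕ) (v : ℕ → α) :
    Prop where
  add_eq : ∀ e, τ.w₁ e + τ.w₂ e = σ.w₁ e + σ.w₂ e
  opt₁ : ∀ a ∈ σ.S₁, ∀ b ∉ σ.S₁, R₁ a b → τ.w₁ b ≤ τ.w₁ a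
  opt₂ : ∀ a ∈ σ.S₂, ∀ b ∉ σ.S₂, R₂ a b → τ.w₂ b ≤ τ.w₂ a
  isPath : IsPath (fun x y => Tight₁ R₁ σ.S₁ τ.w₁ x y ∨ Tight₂ R₂ σ.S₂ τ.w₂ x y)
    (fun x => x ∈ σ.S₁ ∧ x ∉ σ.S₂) (fun x => x ∈ σ.S₂ ∧ x ∉ σ.S₁) m v
  injOn : InjOn v (Set.Iic m)
  short : ∀ i j, i + 1 < j → j ≤ m →
    ¬ (Tight₁ R₁ σ.S₁ τ.w₁ (v i) (v j) ∨ Tight₂ R₂ σ.S₂ τ.w₂ (v i) (v j))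
  mem₁ : ∀ x, x ∈ τ.S₁ ↔ (x ∈ σ.S₁ ∧ ∀ i < m, Tight₁ R₁ σ.S₁ τ.w₁ (v i) (v (i + 1)) → v i ≠ x) ∨
    ∃ i < m, Tight₁ R₁ σ.S₁ τ.w₁ (v i) (v (i + 1)) ∧ v (i + 1) = x
  mem₂ : ∀ x, x ∈ τ.S₂ ↔
    (x ∈ σ.S₂ ∧ ∀ i < m, ¬ Tight₁ R₁ σ.S₁ τ.w₁ (v i) (v (i + 1)) → v (i + 1) ≠ x) ∨
    ∃ i < m, ¬ Tight₁ R₁ σ.S₁ τ.w₁ (v i) (v (i + 1)) ∧ v i = x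

variable {R₁ R₂ : α → α → Prop} {σ τ : Splitting α} {m : ℕ} {v : ℕ → α}

/-- The steps tight for `M₁` form one simultaneous exchange in the first base, the remaining steps
one in the second. The absence of shortcuts is the triangularity that `IsLocalMax.multi_exchange`
needs. -/
lemma IsAugmentation.valid (h : IsAugmentation R₁ R₂ σ τ m v) (hE₁ : M₁.E = univ)
    (hE₂ : M₂.E = univ) (hσ : σ.Valid M₁ M₂)
    (hR₁ : ∀ a b, R₁ a b ↔ b ∉ M₁.closure ((σ.S₁ : Set α) \ {a}))
    (hR₂ : ∀ a b, R₂ a b ↔ b ∉ M₂.closure ((σ.S₂ : Set α) \ {a})) : τ.Valid M₁ M₂ := by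
  classical
  constructor
  · have h1 : IsLocalMax M₁ τ.w₁ σ.S₁ :=
      ⟨hσ.1.1, fun a ha b hb hab => h.opt₁ a ha b hb ((hR₁ a b).2 hab)⟩
    set I := (Finset.range m).filter fun i => Tight₁ R₁ σ.S₁ τ.w₁ (v i) (v (i + 1)) with hI
    have hIm : ∀ i ∈ I, i < m ∧ Tight₁ R₁ σ.S₁ τ.w₁ (v i) (v (i + 1)) := by simp [hI]
    have h2 := h1.multi_exchange hE₁ v (fun i => v (i + 1)) I (fun i => (i : ℤ))
      Nat.cast_injective
      (fun i hi j hj hij => h.injOn (hIm i hi).1.le (hIm j hj).1.le hij)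
      (fun i hi j hj hij => by
        have := h.injOn (show i + 1 ∈ Set.Iic m from (hIm i hi).1)
          (show j + 1 ∈ Set.Iic m from (hIm j hj).1) hij
        omega)
      (fun i hi => (hIm i hi).2.1) (fun i hi => (hIm i hi).2.2.1)
      (fun i hi => (hIm i hi).2.2.2.2) (fun i hi => (hR₁ _ _).1 (hIm i hi).2.2.2.1)
      (fun i hi j hj hji hw => by
        by_contra hcon
        have hji : j < i := by exact_mod_cast hji
        exact h.short j (i + 1) (by omega) (hIm i hi).1
          (Or.inl ⟨(hIm j hj).2.1, (hIm i hi).2.2.1, (hR₁ _ _).2 hcon, hw.symm⟩))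
    convert! h2
    ext x
    rw [h.mem₁]
    simp only [Finset.mem_union, Finset.mem_sdiff, Finset.mem_image, hI, Finset.mem_filter,
      Finset.mem_range, not_exists, not_and, and_assoc]
  · have h1 : IsLocalMax M₂ τ.w₂ σ.S₂ :=
      ⟨hσ.2.1, fun a ha b hb hab => h.opt₂ a ha b hb ((hR₂ a b).2 hab)⟩
    set I := (Finset.range m).filter fun i => ¬ Tight₁ R₁ σ.S₁ τ.w₁ (v i) (v (i + 1)) with hI
    have hIm : ∀ i ∈ I, i < m ∧ Tight₂ R₂ σ.S₂ τ.w₂ (v i) (v (i + 1)) := by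
      intro i hi
      simp only [hI, Finset.mem_filter, Finset.mem_range] at hi
      exact ⟨hi.1, (h.isPath.2.2 i hi.1).resolve_left hi.2⟩
    -- In the second base `v (i + 1)` leaves and `v i` enters, so the order of the indices that
    -- excludes shortcuts is reversed.
    have h2 := h1.multi_exchange hE₂ (fun i => v (i + 1)) v I (fun i => -(i : ℤ))
      (fun i j hij => by simpa using hij)
      (fun i hi j hj hij => by
        have := h.injOn (show i + 1 ∈ Set.Iic m from (hIm i hi).1)
          (show j + 1 ∈ Set.Iic m from (hIm j hj).1) hij
        omega)
      (fun i hi j hj hij => h.injOn (hIm i hi).1.le (hIm j hj).1.le hij)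
      (fun i hi => (hIm i hi).2.1) (fun i hi => (hIm i hi).2.2.1)
      (fun i hi => (hIm i hi).2.2.2.2) (fun i hi => (hR₂ _ _).1 (hIm i hi).2.2.2.1)
      (fun i hi j hj hji hw => by
        by_contra hcon
        have hji : i < j := by simpa using hji
        exact h.short i (j + 1) (by omega) (hIm j hj).1
          (Or.inr ⟨(hIm j hj).2.1, (hIm i hi).2.2.1, (hR₂ _ _).2 hcon, hw.symm⟩))
    convert! h2
    ext x
    rw [h.mem₂]
    simp only [Finset.mem_union, Finset.mem_sdiff, Finset.mem_image, hI, Finset.mem_filter,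
      Finset.mem_range, not_exists, not_and, and_assoc]

/-- The two kinds of steps alternate along the path, so an inner vertex enters both bases or leaves
both. Nothing joins the difference, and `v 0` drops out of it. -/
lemma IsAugmentation.card_lt (h : IsAugmentation R₁ R₂ σ τ m v) :
    (τ.S₁ \ τ.S₂).card < (σ.S₁ \ σ.S₂).card := by
  have hm : 0 < m := by
    rcases Nat.eq_zero_or_pos m with rfl | hm
    · exact absurd h.isPath.1.1 h.isPath.2.1.2
    · exact hm
  have key : ∀ x ∈ τ.S₁ \ τ.S₂, x ∈ (σ.S₁ \ σ.S₂).erase (v 0) := by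
    intro x hx
    rw [Finset.mem_sdiff, h.mem₁, h.mem₂] at hx
    obtain ⟨h1, h2⟩ := hx
    push Not at h2
    obtain ⟨h2, h3⟩ := h2
    have hT₂ : ∀ i < m, ¬ Tight₁ R₁ σ.S₁ τ.w₁ (v i) (v (i + 1)) → v i ∉ σ.S₂ ∧ v (i + 1) ∈ σ.S₂ :=
      fun i hi hn => ⟨((h.isPath.2.2 i hi).resolve_left hn).2.1,
        ((h.isPath.2.2 i hi).resolve_left hn).1⟩
    rcases h1 with ⟨hx1, hx2⟩ | ⟨i, hi, ht, rfl⟩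
    · by_cases hxS : x ∈ σ.S₂
      · obtain ⟨i, hi, hn, rfl⟩ := h2 hxS
        rcases (Nat.succ_le_of_lt hi).lt_or_eq with hlt | heq
        · by_cases ht : Tight₁ R₁ σ.S₁ τ.w₁ (v (i + 1)) (v (i + 1 + 1))
          · exact absurd rfl (hx2 (i + 1) hlt ht)
          · exact absurd hxS (hT₂ _ hlt ht).1
        · have h4 : v (i + 1) = v m := congrArg v heq
          exact absurd (h4 ▸ hx1) h.isPath.2.1.2
      · refine Finset.mem_erase.2 ⟨?_, Finset.mem_sdiff.2 ⟨hx1, hxS⟩⟩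
        rintro rfl
        by_cases ht : Tight₁ R₁ σ.S₁ τ.w₁ (v 0) (v (0 + 1))
        · exact hx2 0 hm ht rfl
        · exact h3 0 hm ht rfl
    · rcases (Nat.succ_le_of_lt hi).lt_or_eq with hlt | heq
      · refine absurd rfl (h3 (i + 1) hlt fun hc => ht.2.1 hc.1)
      · have h4 : v (i + 1) = v m := congrArg v heq
        obtain ⟨j, hj, hn, hjx⟩ := h2 (h4 ▸ h.isPath.2.1.1)
        have := h.injOn (show j + 1 ∈ Set.Iic m from hj) (show i + 1 ∈ Set.Iic m from hi) hjx
        have hji : j = i := by omega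
        exact absurd (hji ▸ ht) hn
  have hv0 : v 0 ∈ σ.S₁ \ σ.S₂ := Finset.mem_sdiff.2 h.isPath.1
  calc (τ.S₁ \ τ.S₂).card ≤ ((σ.S₁ \ σ.S₂).erase (v 0)).card := Finset.card_le_card key
    _ < _ := Finset.card_erase_lt_of_mem hv0

/-- While no path of tight exchanges joins a source to a target, one unit of weight is shifted on
the set reached. Each shift lowers the total weight of the two bases, which is bounded below by the
weight of the common base `T`. The bases stay fixed during the shifts, so `R₁` and `R₂` remain the
right exchange relations. -/
lemma exists_isAugmentation (hE₁ : M₁.E = univ) (hE₂ : M₂.E = univ) (hσ : σ.Valid M₁ M₂)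
    (hR₁ : ∀ a b, R₁ a b ↔ b ∉ M₁.closure ((σ.S₁ : Set α) \ {a}))
    (hR₂ : ∀ a b, R₂ a b ↔ b ∉ M₂.closure ((σ.S₂ : Set α) \ {a}))
    (hne : ¬ σ.S₁ ⊆ σ.S₂) {T : Finset α} (hT₁ : M₁.IsBase (T : Set α))
    (hT₂ : M₂.IsBase (T : Set α)) : ∃ τ m v, IsAugmentation R₁ R₂ σ τ m v := by
  classical
  suffices H : ∀ (n : ℕ) (u₁ u₂ : α → ℤ), (∀ e, u₁ e + u₂ e = σ.w₁ e + σ.w₂ e) →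
      IsLocalMax M₁ u₁ σ.S₁ → IsLocalMax M₂ u₂ σ.S₂ →
      ∑ e ∈ σ.S₁, u₁ e + ∑ e ∈ σ.S₂, u₂ e ≤ n + ∑ e ∈ T, (σ.w₁ e + σ.w₂ e) →
      ∃ τ m v, IsAugmentation R₁ R₂ σ τ m v from by
    refine H (∑ e ∈ σ.S₁, σ.w₁ e + ∑ e ∈ σ.S₂, σ.w₂ e - ∑ e ∈ T, (σ.w₁ e + σ.w₂ e)).toNat
      σ.w₁ σ.w₂ (fun _ => rfl) hσ.1 hσ.2 ?_
    have := Int.self_le_toNat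
      (∑ e ∈ σ.S₁, σ.w₁ e + ∑ e ∈ σ.S₂, σ.w₂ e - ∑ e ∈ T, (σ.w₁ e + σ.w₂ e))
    linarith
  intro n
  induction n with
  | zero => ?_
  | succ n ih => ?_
  all_goals
    intro u₁ u₂ hu hl₁ hl₂ hn
    set r : α → α → Prop := fun x y => Tight₁ R₁ σ.S₁ u₁ x y ∨ Tight₂ R₂ σ.S₂ u₂ x y with hr
    by_cases hpath : ∃ x y, (x ∈ σ.S₁ ∧ x ∉ σ.S₂) ∧ (y ∈ σ.S₂ ∧ y ∉ σ.S₁) ∧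
        Relation.ReflTransGen r x y
    · obtain ⟨x, y, hx, hy, hxy⟩ := hpath
      obtain ⟨m, v, hv0, hvm, hv⟩ :=
        exists_isPath_of_reflTransGen (s := fun x => x ∈ σ.S₁ ∧ x ∉ σ.S₂) hx hxy
      have hvm : v m = y := hvm
      obtain ⟨m, v, hv, hinj, hshort⟩ := exists_isPath_minimal (r := r)
        (s := fun x => x ∈ σ.S₁ ∧ x ∉ σ.S₂) (t := fun x => x ∈ σ.S₂ ∧ x ∉ σ.S₁) (m := m) (v := v)
        ⟨hv0, hvm ▸ hy, hv⟩
      refine ⟨⟨u₁, u₂,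
        Finset.univ.filter fun x => (x ∈ σ.S₁ ∧
          ∀ i < m, Tight₁ R₁ σ.S₁ u₁ (v i) (v (i + 1)) → v i ≠ x) ∨
          ∃ i < m, Tight₁ R₁ σ.S₁ u₁ (v i) (v (i + 1)) ∧ v (i + 1) = x,
        Finset.univ.filter fun x => (x ∈ σ.S₂ ∧
          ∀ i < m, ¬ Tight₁ R₁ σ.S₁ u₁ (v i) (v (i + 1)) → v (i + 1) ≠ x) ∨
          ∃ i < m, ¬ Tight₁ R₁ σ.S₁ u₁ (v i) (v (i + 1)) ∧ v i = x⟩, m, v, hu,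
        fun a ha b hb hab => hl₁.2 a ha b hb ((hR₁ a b).1 hab),
        fun a ha b hb hab => hl₂.2 a ha b hb ((hR₂ a b).1 hab), hv, hinj, hshort,
        fun x => by simp, fun x => by simp⟩
    · -- shift the splitting on the set reached from the sources
      push Not at hpath
      set U : Finset α := Finset.univ.filter fun y =>
        ∃ x, (x ∈ σ.S₁ ∧ x ∉ σ.S₂) ∧ Relation.ReflTransGen r x y with hU
      have hUs : ∀ x, x ∈ σ.S₁ → x ∉ σ.S₂ → x ∈ U := fun x h1 h2 => by
        simp only [hU, Finset.mem_filter, Finset.mem_univ, true_and]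
        exact ⟨x, ⟨h1, h2⟩, .refl⟩
      have hUt : ∀ y ∈ U, y ∈ σ.S₂ → y ∈ σ.S₁ := fun y hy h2 => by
        simp only [hU, Finset.mem_filter, Finset.mem_univ, true_and] at hy
        obtain ⟨x, hx, hxy⟩ := hy
        by_contra h1
        exact hpath x y hx ⟨h2, h1⟩ hxy
      have hUr : ∀ x ∈ U, ∀ y, r x y → y ∈ U := fun x hx y hxy => by
        simp only [hU, Finset.mem_filter, Finset.mem_univ, true_and] at hx ⊢
        obtain ⟨z, hz, hzx⟩ := hx
        exact ⟨z, hz, hzx.tail hxy⟩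
      set u₁' : α → ℤ := fun e => u₁ e - if e ∈ U then 1 else 0 with hu₁'
      set u₂' : α → ℤ := fun e => u₂ e + if e ∈ U then 1 else 0 with hu₂'
      have hl₁' : IsLocalMax M₁ u₁' σ.S₁ := by
        refine ⟨hl₁.1, fun a ha b hb hab => ?_⟩
        have h1 := hl₁.2 a ha b hb hab
        simp only [hu₁']
        by_cases haU : a ∈ U
        · by_cases hbU : b ∈ U
          · simp [haU, hbU, h1]
          -- Integrality: an exchange leaving `U` is not tight, so its slack is at least `1` and
          -- absorbs the shift.
          · have : u₁ a ≠ u₁ b := fun he =>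
              hbU (hUr a haU b (Or.inl ⟨ha, hb, (hR₁ a b).2 hab, he⟩))
            simp only [haU, hbU, if_true, if_false]
            omega
        · simp only [haU, if_false]
          split_ifs <;> omega
      have hl₂' : IsLocalMax M₂ u₂' σ.S₂ := by
        refine ⟨hl₂.1, fun a ha b hb hab => ?_⟩
        have h1 := hl₂.2 a ha b hb hab
        simp only [hu₂']
        by_cases hbU : b ∈ U
        · by_cases haU : a ∈ U
          · simp [haU, hbU, h1]
          · have : u₂ a ≠ u₂ b := fun he =>
              haU (hUr b hbU a (Or.inr ⟨ha, hb, (hR₂ a b).2 hab, he⟩))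
            simp only [haU, hbU, if_true, if_false]
            omega
        · simp only [hbU, if_false]
          split_ifs <;> omega
      have hsum : ∑ e ∈ σ.S₁, u₁' e + ∑ e ∈ σ.S₂, u₂' e + 1 ≤
          ∑ e ∈ σ.S₁, u₁ e + ∑ e ∈ σ.S₂, u₂ e := by
        simp only [hu₁', hu₂', Finset.sum_sub_distrib, Finset.sum_add_distrib,
          Finset.sum_ite_mem, Finset.sum_const, nsmul_eq_mul, mul_one]
        -- `U` contains the nonempty set `S₁ \ S₂` and misses `S₂ \ S₁`.
        have : (σ.S₂ ∩ U).card < (σ.S₁ ∩ U).card := by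
          apply Finset.card_lt_card
          obtain ⟨x, hx1, hx2⟩ := Finset.not_subset.1 hne
          refine ⟨fun y hy => ?_, fun h => hx2 ?_⟩
          · rw [Finset.mem_inter] at hy ⊢
            exact ⟨hUt y hy.2 hy.1, hy.2⟩
          · exact (Finset.mem_inter.1 (h (Finset.mem_inter.2 ⟨hx1, hUs x hx1 hx2⟩))).1
        have : ((σ.S₂ ∩ U).card : ℤ) + 1 ≤ (σ.S₁ ∩ U).card := by exact_mod_cast this
        linarith
      have hu' : ∀ e, u₁' e + u₂' e = σ.w₁ e + σ.w₂ e := fun e => by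
        rw [← hu e]; simp only [hu₁', hu₂']; ring
      -- In the successor case the budget `n` pays for the shift. At `0` it is exhausted, and the
      -- shifted weights contradict optimality against `T`.
      first
      | exact ih u₁' u₂' hu' hl₁' hl₂' (by push_cast at hn; linarith)
      | exfalso
        have h1 := hl₁'.sum_le hE₁ hT₁
        have h2 := hl₂'.sum_le hE₂ hT₂
        have h3 : ∑ e ∈ T, (σ.w₁ e + σ.w₂ e) = ∑ e ∈ T, u₁' e + ∑ e ∈ T, u₂' e := by
          rw [← Finset.sum_add_distrib]
          exact Finset.sum_congr rfl fun e _ => (hu' e).symm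
        push_cast at hn
        linarith

end Splitting

/-! ### Greedy bases and their monotonicity -/

section Greedy

variable {α : Type} [Fintype α] {M : Matroid α} {w w' : α → ℤ}

/-- Elements are processed by decreasing weight, ties being broken by a fixed enumeration. -/
noncomputable def greedyKey (w : α → ℤ) (e : α) : ℤ ×ₗ Fin (Fintype.card α) :=
  toLex (-w e, Fintype.equivFin α e)

lemma greedyKey_injective (w : α → ℤ) : Function.Injective (greedyKey w) := fun e f h => by
  have h' : (-w e, Fintype.equivFin α e) = (-w f, Fintype.equivFin α f) := toLex.injective h
  exact (Fintype.equivFin α).injective (Prod.ext_iff.1 h').2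

lemma greedyKey_lt {e f : α} : greedyKey w f < greedyKey w e ↔
    w e < w f ∨ w f = w e ∧ Fintype.equivFin α f < Fintype.equivFin α e := by
  rw [greedyKey, greedyKey, Prod.Lex.toLex_lt_toLex]
  simp

/-- The elements processed before `e`. -/
def earlier (w : α → ℤ) (e : α) : Set α := {f | greedyKey w f < greedyKey w e}

open Classical in
/-- The elements that are not spanned by those processed before. -/
noncomputable def greedyBase (M : Matroid α) (w : α → ℤ) : Finset α :=
  Finset.univ.filter fun e => e ∉ M.closure (earlier w e)

lemma mem_greedyBase {e : α} : e ∈ greedyBase M w ↔ e ∉ M.closure (earlier w e) := by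
  simp [greedyBase]

lemma mem_closure_greedyBase (hE : M.E = univ) (w : α → ℤ) (e : α) :
    e ∈ M.closure ((greedyBase M w : Set α) ∩ {f | greedyKey w f ≤ greedyKey w e}) := by
  have : IsTrans α fun f e => greedyKey w f < greedyKey w e := ⟨fun _ _ _ h h' => h.trans h'⟩
  have : Std.Irrefl fun f e : α => greedyKey w f < greedyKey w e := ⟨fun _ => lt_irrefl _⟩
  have wf : WellFounded fun f e : α => greedyKey w f < greedyKey w e :=
    Finite.wellFounded_of_trans_of_irrefl _
  induction e using wf.induction with
  | _ e ih =>
  by_cases he : e ∈ greedyBase M w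
  · exact M.mem_closure_of_mem' ⟨he, le_refl (greedyKey w e)⟩ (by simp [hE])
  · rw [mem_greedyBase, not_not] at he
    refine M.closure_subset_closure_of_subset_closure (fun f hf => ?_) he
    have hf : greedyKey w f < greedyKey w e := hf
    have hsub : (greedyBase M w : Set α) ∩ {g | greedyKey w g ≤ greedyKey w f} ⊆
        (greedyBase M w : Set α) ∩ {g | greedyKey w g ≤ greedyKey w e} :=
      fun g hg => ⟨hg.1, le_trans hg.2 hf.le⟩
    exact M.closure_subset_closure hsub (ih f hf)

/-- In a circuit the element processed last is spanned by the others, hence was not picked. An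
unpicked `b` is spanned by picked elements processed no later, so it cannot replace a lighter `a`.
-/
lemma greedyBase_isLocalMax (hE : M.E = univ) (w : α → ℤ) : IsLocalMax M w (greedyBase M w) := by
  classical
  have hbase : M.IsBase (greedyBase M w : Set α) := by
    rw [Matroid.isBase_iff_indep_closure_eq]
    constructor
    · by_contra hcon
      have hdep : M.Dep (greedyBase M w : Set α) := ⟨hcon, by simp [hE]⟩
      obtain ⟨C, hCs, hC⟩ := hdep.exists_isCircuit_subset
      obtain ⟨e, heC, hmax⟩ :=
        Set.exists_max_image C (greedyKey w) (Set.toFinite C) hC.nonempty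
      have h1 := hC.mem_closure_sdiff_singleton_of_mem heC
      refine mem_greedyBase.1 (hCs heC) (M.closure_subset_closure (fun f hf => ?_) h1)
      exact lt_of_le_of_ne (hmax f hf.1) fun h => hf.2 (greedyKey_injective w h)
    · rw [hE, eq_univ_iff_forall]
      exact fun e => M.closure_subset_closure inter_subset_left (mem_closure_greedyBase hE w e)
  refine ⟨hbase, fun a ha b hb hab => ?_⟩
  by_contra hlt
  rw [not_le] at hlt
  have hsub : (greedyBase M w : Set α) ∩ {f | greedyKey w f ≤ greedyKey w b} ⊆
      (greedyBase M w : Set α) \ {a} := by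
    refine fun f hf => ⟨hf.1, ?_⟩
    rintro rfl
    have h1 : greedyKey w f ≤ greedyKey w b := hf.2
    exact absurd (greedyKey_lt.2 (Or.inl hlt)) (not_lt.2 h1)
  exact hab (M.closure_subset_closure hsub (mem_closure_greedyBase hE w b))

lemma earlier_subset {e : α} (he : w' e = w e) (hle : ∀ f, w' f ≤ w f) :
    earlier w' e ⊆ earlier w e := by
  intro f hf
  have hf : greedyKey w' f < greedyKey w' e := hf
  change greedyKey w f < greedyKey w e
  rw [greedyKey_lt] at hf ⊢
  have := hle f
  rcases hf with h | ⟨h, h'⟩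
  · left; omega
  · rcases this.lt_or_eq with h2 | h2
    · left; omega
    · right; exact ⟨by omega, h'⟩

/-- Lowering other weights only shrinks the set processed before `e`, ties being broken
independently of the weights. Read backwards, raising other weights cannot bring an element of
unchanged weight into the base. -/
lemma mem_greedyBase_of_le {e : α} (he : w' e = w e) (hle : ∀ f, w' f ≤ w f)
    (h : e ∈ greedyBase M w) : e ∈ greedyBase M w' := by
  rw [mem_greedyBase] at h ⊢
  exact fun h' => h (M.closure_subset_closure (earlier_subset he hle) h')

end Greedy

/-! ### Augmentation rounds and the auction -/

/-- How an algorithm accesses two matroids on `α`: it can find greedy bases, and the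
exchanges that are possible in given bases. -/
structure Access (Q A α : Type) where
  bases : (α → ℤ) → (α → ℤ) → ParallelAlg Q A (Finset α × Finset α)
  exchanges : Finset α → Finset α → ParallelAlg Q A ((α → α → Prop) × (α → α → Prop))

/-- The access is correct for `M₁`, `M₂`, with greedy bases found in `t` rounds and exchanges in one
round, using at most `c` queries per round. -/
structure Access.Correct {Q A α : Type} [Fintype α] (acc : Access Q A α) (o : Q → A)
    (M₁ M₂ : Matroid α) (t c : ℕ) : Prop where
  bases_output : ∀ w₁ w₂, (acc.bases w₁ w₂).output o = (greedyBase M₁ w₁, greedyBase M₂ w₂)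
  bases_rounds : ∀ w₁ w₂, (acc.bases w₁ w₂).rounds o ≤ t
  bases_width : ∀ w₁ w₂, (acc.bases w₁ w₂).width o ≤ c
  exchanges_fst : ∀ S₁ S₂ : Finset α, M₁.IsBase (S₁ : Set α) → M₂.IsBase (S₂ : Set α) →
    ∀ a b, ((acc.exchanges S₁ S₂).output o).1 a b ↔ b ∉ M₁.closure ((S₁ : Set α) \ {a})
  exchanges_snd : ∀ S₁ S₂ : Finset α, M₁.IsBase (S₁ : Set α) → M₂.IsBase (S₂ : Set α) →
    ∀ a b, ((acc.exchanges S₁ S₂).output o).2 a b ↔ b ∉ M₂.closure ((S₂ : Set α) \ {a})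
  exchanges_rounds : ∀ S₁ S₂, (acc.exchanges S₁ S₂).rounds o ≤ 1
  exchanges_width : ∀ S₁ S₂, (acc.exchanges S₁ S₂).width o ≤ c

section Algorithm

variable {Q A α : Type} [Fintype α] [DecidableEq α] {M₁ M₂ : Matroid α} {acc : Access Q A α}
  {o : Q → A} {t c : ℕ}

open Classical in
/-- Perform an augmentation if there is one. -/
noncomputable def augment (acc : Access Q A α) (σ : Splitting α) : ParallelAlg Q A (Splitting α) :=
  (acc.exchanges σ.S₁ σ.S₂).bind fun R => .done <|
    if h : ∃ τ m v, Splitting.IsAugmentation R.1 R.2 σ τ m v then h.choose else σ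

lemma augment_rounds (h : acc.Correct o M₁ M₂ t c) (σ : Splitting α) :
    (augment acc σ).rounds o ≤ 1 := by
  simp [augment, h.exchanges_rounds]

lemma augment_width (h : acc.Correct o M₁ M₂ t c) (σ : Splitting α) :
    (augment acc σ).width o ≤ c := by
  simp [augment, h.exchanges_width]

/-- Truncated subtraction covers both outcomes: if there is no augmentation, then `σ.S₁ ⊆ σ.S₂`, and
the difference is already empty. -/
lemma augment_output (h : acc.Correct o M₁ M₂ t c) (hE₁ : M₁.E = univ) (hE₂ : M₂.E = univ)
    {σ τ : Splitting α} (hσ : σ.Valid M₁ M₂) {T : Finset α} (hT₁ : M₁.IsBase (T : Set α))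
    (hT₂ : M₂.IsBase (T : Set α)) (hτ : τ = (augment acc σ).output o) :
    τ.Valid M₁ M₂ ∧ (∀ e, τ.w₁ e + τ.w₂ e = σ.w₁ e + σ.w₂ e) ∧
      (τ.S₁ \ τ.S₂).card ≤ (σ.S₁ \ σ.S₂).card - 1 := by
  have hR₁ := h.exchanges_fst σ.S₁ σ.S₂ hσ.1.1 hσ.2.1
  have hR₂ := h.exchanges_snd σ.S₁ σ.S₂ hσ.1.1 hσ.2.1
  simp only [augment, ParallelAlg.output_bind, ParallelAlg.output_done] at hτ
  split_ifs at hτ with hex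
  · obtain ⟨m, v, haug⟩ := hex.choose_spec
    rw [← hτ] at haug
    have := haug.card_lt
    exact ⟨haug.valid hE₁ hE₂ hσ hR₁ hR₂, haug.add_eq, by omega⟩
  · subst hτ
    have hsub : τ.S₁ ⊆ τ.S₂ := by
      by_contra hne
      exact hex (Splitting.exists_isAugmentation hE₁ hE₂ hσ hR₁ hR₂ hne hT₁ hT₂)
    refine ⟨hσ, fun _ => rfl, ?_⟩
    rw [Finset.sdiff_eq_empty_iff_subset.2 hsub]
    simp

lemma augment_iter_output (h : acc.Correct o M₁ M₂ t c) (hE₁ : M₁.E = univ) (hE₂ : M₂.E = univ)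
    {T : Finset α} (hT₁ : M₁.IsBase (T : Set α)) (hT₂ : M₂.IsBase (T : Set α)) (Y : ℕ)
    {σ τ : Splitting α} (hσ : σ.Valid M₁ M₂)
    (hτ : τ = (ParallelAlg.iter (augment acc) Y σ).output o) :
    τ.Valid M₁ M₂ ∧ (∀ e, τ.w₁ e + τ.w₂ e = σ.w₁ e + σ.w₂ e) ∧
      (τ.S₁ \ τ.S₂).card ≤ (σ.S₁ \ σ.S₂).card - Y := by
  induction Y generalizing σ with
  | zero =>
    simp only [ParallelAlg.iter, ParallelAlg.output_done] at hτ
    subst hτ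
    exact ⟨hσ, fun _ => rfl, by simp⟩
  | succ Y ih =>
    simp only [ParallelAlg.iter, ParallelAlg.output_bind] at hτ
    obtain ⟨h1, h2, h3⟩ := augment_output h hE₁ hE₂ hσ hT₁ hT₂ rfl
    obtain ⟨h4, h5, h6⟩ := ih h1 hτ
    exact ⟨h4, fun e => (h5 e).trans (h2 e), by omega⟩

/-- The first weight function after the element `e` has been raised `p e` times. -/
def auctionWeight₁ (u : α → ℤ) (δ : ℤ) (p : α → ℕ) (e : α) : ℤ := u e - δ * (p e / 2 : ℕ)

/-- The second weight function after the element `e` has been raised `p e` times. -/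
def auctionWeight₂ (w u : α → ℤ) (δ : ℤ) (p : α → ℕ) (e : α) : ℤ :=
  w e - u e + δ * ((p e + 1) / 2 : ℕ)

/-- The elements which are only in the first base and have been raised less than `2 * d` times. -/
def contested (d : ℕ) (B : Finset α × Finset α) (p : α → ℕ) : Finset α :=
  (B.1 \ B.2).filter fun e => p e < 2 * d

/-- Raise all the contested elements, if there are sufficiently many of them. -/
def raise (k d : ℕ) (B : Finset α × Finset α) (p : α → ℕ) : α → ℕ :=
  if k < (contested d B p).card * d then fun e => if e ∈ contested d B p then p e + 1 else p e
  else p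

/-- One round of the auction. -/
def auction (acc : Access Q A α) (k d : ℕ) (w u : α → ℤ) (δ : ℤ) (p : α → ℕ) :
    ParallelAlg Q A (α → ℕ) :=
  (acc.bases (auctionWeight₁ u δ p) (auctionWeight₂ w u δ p)).bind fun B => .done (raise k d B p)

/-- The greedy bases for the current weights of the auction. -/
noncomputable def auctionBases (M₁ M₂ : Matroid α) (w u : α → ℤ) (δ : ℤ) (p : α → ℕ) :
    Finset α × Finset α :=
  (greedyBase M₁ (auctionWeight₁ u δ p), greedyBase M₂ (auctionWeight₂ w u δ p))

lemma auction_output (h : acc.Correct o M₁ M₂ t c) (k d : ℕ) (w u : α → ℤ) (δ : ℤ) (p : α → ℕ) :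
    (auction acc k d w u δ p).output o = raise k d (auctionBases M₁ M₂ w u δ p) p := by
  simp [auction, h.bases_output, auctionBases]

lemma auction_rounds (h : acc.Correct o M₁ M₂ t c) (k d : ℕ) (w u : α → ℤ) (δ : ℤ) (p : α → ℕ) :
    (auction acc k d w u δ p).rounds o ≤ t := by
  simp [auction, h.bases_rounds]

lemma auction_width (h : acc.Correct o M₁ M₂ t c) (k d : ℕ) (w u : α → ℤ) (δ : ℤ) (p : α → ℕ) :
    (auction acc k d w u δ p).width o ≤ c := by
  simp [auction, h.bases_width]

/-- The invariant of the auction. -/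
structure AuctionInv (M₁ M₂ : Matroid α) (d : ℕ) (w u : α → ℤ) (δ : ℤ) (p : α → ℕ) : Prop where
  le : ∀ e, p e ≤ 2 * d
  mem : ∀ e, p e ≠ 0 → e ∈ (auctionBases M₁ M₂ w u δ p).2 → e ∈ (auctionBases M₁ M₂ w u δ p).1

variable {k d : ℕ} {w u : α → ℤ} {δ : ℤ}

/-- Raising an even `p e` changes only the second weight of `e`, so `e` stays in the first base;
raising an odd one changes only the first weight, so `e` stays outside the second. Either way the
implication `mem` survives. -/
lemma AuctionInv.raise (hδ : 0 ≤ δ) {p : α → ℕ} (hp : AuctionInv M₁ M₂ d w u δ p) :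
    AuctionInv M₁ M₂ d w u δ (raise k d (auctionBases M₁ M₂ w u δ p) p) := by
  rw [MatroidIntersection.raise]
  split_ifs with hk
  swap
  · exact hp
  set C := contested d (auctionBases M₁ M₂ w u δ p) p with hC
  set q : α → ℕ := fun e => if e ∈ C then p e + 1 else p e with hq
  have hCmem : ∀ e ∈ C, e ∈ (auctionBases M₁ M₂ w u δ p).1 ∧ e ∉ (auctionBases M₁ M₂ w u δ p).2 ∧
      p e < 2 * d := fun e he => by
    simp only [hC, contested, Finset.mem_filter, Finset.mem_sdiff] at he
    exact ⟨he.1.1, he.1.2, he.2⟩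
  have hpq : ∀ e, p e ≤ q e := fun e => by simp only [hq]; split_ifs <;> omega
  have hw₁ : ∀ e, auctionWeight₁ u δ q e ≤ auctionWeight₁ u δ p e := fun e => by
    have : (p e / 2 : ℕ) ≤ q e / 2 := Nat.div_le_div_right (hpq e)
    have : ((p e / 2 : ℕ) : ℤ) ≤ (q e / 2 : ℕ) := by exact_mod_cast this
    have := mul_le_mul_of_nonneg_left this hδ
    simp only [auctionWeight₁]; linarith
  have hw₂ : ∀ e, auctionWeight₂ w u δ p e ≤ auctionWeight₂ w u δ q e := fun e => by
    have : ((p e + 1) / 2 : ℕ) ≤ (q e + 1) / 2 :=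
      Nat.div_le_div_right (Nat.add_le_add_right (hpq e) 1)
    have : (((p e + 1) / 2 : ℕ) : ℤ) ≤ ((q e + 1) / 2 : ℕ) := by exact_mod_cast this
    have := mul_le_mul_of_nonneg_left this hδ
    simp only [auctionWeight₂]; linarith
  have hstay₁ : ∀ e, q e / 2 = p e / 2 → e ∈ (auctionBases M₁ M₂ w u δ p).1 →
      e ∈ (auctionBases M₁ M₂ w u δ q).1 := fun e he =>
    mem_greedyBase_of_le (by simp only [auctionWeight₁, he]) hw₁
  have hstay₂ : ∀ e, (q e + 1) / 2 = (p e + 1) / 2 → e ∈ (auctionBases M₁ M₂ w u δ q).2 →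
      e ∈ (auctionBases M₁ M₂ w u δ p).2 := fun e he =>
    mem_greedyBase_of_le (by simp only [auctionWeight₂, he]) hw₂
  refine ⟨fun e => ?_, fun e hqe he => ?_⟩
  · simp only [hq]
    split_ifs with heC
    · have := (hCmem e heC).2.2
      omega
    · exact hp.le e
  · by_cases heC : e ∈ C
    · obtain ⟨h1, h2, -⟩ := hCmem e heC
      have hqe : q e = p e + 1 := by simp [hq, heC]
      rcases Nat.even_or_odd' (p e) with ⟨j, hj | hj⟩
      · exact hstay₁ e (by omega) h1
      · exact absurd (hstay₂ e (by omega) he) h2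
    · have hqe' : q e = p e := by simp [hq, heC]
      exact hstay₁ e (by rw [hqe']) (hp.mem e (by rwa [← hqe']) (hstay₂ e (by rw [hqe']) he))

/-- Each effective round adds more than `k / d` to `∑ e, p e`. Once few elements are contested,
`raise` is the identity and this remains so. -/
lemma auction_iter_output (h : acc.Correct o M₁ M₂ t c) (hδ : 0 ≤ δ) (X : ℕ) {p : α → ℕ}
    (hp : p = (ParallelAlg.iter (auction acc k d w u δ) X fun _ => 0).output o) :
    AuctionInv M₁ M₂ d w u δ p ∧
      ((contested d (auctionBases M₁ M₂ w u δ p) p).card * d ≤ k ∨ X * k ≤ d * ∑ e, p e) := by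
  rw [ParallelAlg.output_iter] at hp
  subst hp
  induction X with
  | zero => exact ⟨⟨by simp, by simp⟩, by simp⟩
  | succ X ih =>
    rw [Function.iterate_succ_apply', auction_output h]
    set p := (fun s => (auction acc k d w u δ s).output o)^[X] fun _ => 0
    refine ⟨ih.1.raise hδ, ?_⟩
    rw [raise]
    split_ifs with hk
    · rcases ih.2 with h1 | h1
      · omega
      · right
        have : ∑ e, (if e ∈ contested d (auctionBases M₁ M₂ w u δ p) p then p e + 1 else p e) =
            ∑ e, p e + (contested d (auctionBases M₁ M₂ w u δ p) p).card := by
          rw [← Finset.sum_filter_add_sum_filter_not Finset.univ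
            (· ∈ contested d (auctionBases M₁ M₂ w u δ p) p) p]
          rw [Finset.sum_ite, Finset.sum_add_distrib]
          simp
          ring
        rw [this]
        nlinarith
    · exact Or.inl (not_lt.1 hk)

end Algorithm

/-! ### Scaling phases -/

section Algorithm

variable {Q A α : Type} [Fintype α] [DecidableEq α] {M₁ M₂ : Matroid α} {acc : Access Q A α}
  {o : Q → A} {t c k d : ℕ} {w u : α → ℤ} {δ : ℤ}

/-- When few elements are contested, the two greedy bases of the auction are close. -/
lemma AuctionInv.card_sdiff_le (hE₁ : M₁.E = univ) (hE₂ : M₂.E = univ)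
    (hk₁ : ∀ B : Finset α, M₁.IsBase (B : Set α) → B.card = k)
    (hk₂ : ∀ B : Finset α, M₂.IsBase (B : Set α) → B.card = k) (hδ : 0 < δ) {v : α → ℤ}
    {S : Finset α} (hS₁ : IsLocalMax M₁ u S) (hS₂ : IsLocalMax M₂ v S)
    (huv : ∀ e, |u e + v e - w e| ≤ 2 * δ) {p : α → ℕ} (hp : AuctionInv M₁ M₂ d w u δ p)
    (hfew : (contested d (auctionBases M₁ M₂ w u δ p) p).card * d ≤ k) :
    ((auctionBases M₁ M₂ w u δ p).1 \ (auctionBases M₁ M₂ w u δ p).2).card * d ≤ 6 * k := by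
  have hG₁ := greedyBase_isLocalMax hE₁ (auctionWeight₁ u δ p)
  have hG₂ := greedyBase_isLocalMax hE₂ (auctionWeight₂ w u δ p)
  have hmem := hp.mem
  have hle := hp.le
  simp only [contested, auctionBases] at hfew hmem ⊢
  set S₁ := greedyBase M₁ (auctionWeight₁ u δ p)
  set S₂ := greedyBase M₂ (auctionWeight₂ w u δ p)
  set h : α → ℤ := fun e => ((p e / 2 : ℕ) : ℤ) with hh
  set g : α → ℤ := fun e => (((p e + 1) / 2 : ℕ) : ℤ) with hg
  have hhg : ∀ e, h e ≤ g e := fun e => by simp only [hh, hg]; omega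
  have hgh : ∀ e, g e ≤ h e + 1 := fun e => by simp only [hh, hg]; omega
  have hh0 : ∀ e, 0 ≤ h e := fun e => by simp only [hh]; positivity
  have cS : (S.card : ℤ) = k := by exact_mod_cast hk₁ S hS₁.1
  have cS₂ : (S₂.card : ℤ) = k := by exact_mod_cast hk₂ S₂ hG₂.1
  have e1 := hG₁.sum_le hE₁ hS₁.1
  have e2 := hS₁.sum_le hE₁ hG₁.1
  have e3 := hG₂.sum_le hE₂ hS₂.1
  have e4 := hS₂.sum_le hE₂ hG₂.1
  simp only [auctionWeight₁, auctionWeight₂, Finset.sum_sub_distrib, Finset.sum_add_distrib,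
    ← Finset.mul_sum] at e1 e3
  -- Optimality of `S₁` for the lowered weights is added to optimality of `S` for `u`; the terms in
  -- `u` cancel.
  have e5 : ∑ e ∈ S₁, h e ≤ ∑ e ∈ S, h e := by
    have : δ * ∑ e ∈ S₁, h e ≤ δ * ∑ e ∈ S, h e := by simp only [hh]; linarith
    exact le_of_mul_le_mul_left this hδ
  have e6 : ∑ e ∈ S, v e ≤ ∑ e ∈ S, w e - ∑ e ∈ S, u e + 2 * δ * k := by
    have : ∑ e ∈ S, v e ≤ ∑ e ∈ S, (w e - u e + 2 * δ) :=
      Finset.sum_le_sum fun e _ => by have := (abs_le.1 (huv e)).2; linarith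
    rw [Finset.sum_add_distrib, Finset.sum_sub_distrib, Finset.sum_const, nsmul_eq_mul, cS] at this
    linarith
  have e7 : ∑ e ∈ S₂, w e - ∑ e ∈ S₂, u e ≤ ∑ e ∈ S₂, v e + 2 * δ * k := by
    have : ∑ e ∈ S₂, (w e - u e - 2 * δ) ≤ ∑ e ∈ S₂, v e :=
      Finset.sum_le_sum fun e _ => by have := (abs_le.1 (huv e)).1; linarith
    rw [Finset.sum_sub_distrib, Finset.sum_sub_distrib, Finset.sum_const, nsmul_eq_mul, cS₂] at this
    linarith
  -- The error `2 * δ` of the old splitting is paid once on `S` and once on `S₂`, each of which has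
  -- `k` elements.
  have e8 : ∑ e ∈ S, g e ≤ ∑ e ∈ S₂, g e + 4 * k := by
    have : δ * ∑ e ∈ S, g e ≤ δ * (∑ e ∈ S₂, g e + 4 * k) := by simp only [hg]; linarith
    exact le_of_mul_le_mul_left this hδ
  have e9 : ∑ e ∈ S, h e ≤ ∑ e ∈ S, g e := Finset.sum_le_sum fun e _ => hhg e
  have e10 : ∑ e ∈ S₂, g e ≤ ∑ e ∈ S₂, h e + k := by
    have : ∑ e ∈ S₂, g e ≤ ∑ e ∈ S₂, (h e + 1) := Finset.sum_le_sum fun e _ => hgh e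
    rw [Finset.sum_add_distrib, Finset.sum_const, nsmul_eq_mul, cS₂] at this
    linarith
  have e11 : ∑ e ∈ S₂ \ S₁, h e = 0 := by
    refine Finset.sum_eq_zero fun e he => ?_
    rw [Finset.mem_sdiff] at he
    have : p e = 0 := by
      by_contra hne
      exact he.2 (hmem e hne he.1)
    simp [hh, this]
  -- The chain is `S₁` with `h`, `S` with `h`, `S` with `g`, `S₂` with `g`, `S₂` with `h`, losing `4
  -- * k` and then `k`. The common part of `S₁` and `S₂` cancels.
  have e12 : ∑ e ∈ S₁ \ S₂, h e ≤ 5 * k := by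
    have h1 := Finset.sum_inter_add_sum_sdiff S₁ S₂ h
    have h2 := Finset.sum_inter_add_sum_sdiff S₂ S₁ h
    rw [Finset.inter_comm] at h2
    linarith
  -- Such an element has been raised exactly `2 * d` times, so `h e = d`. The contested elements
  -- contribute the sixth `k`.
  have e13 : ((S₁ \ S₂).filter fun e => ¬ p e < 2 * d).card * (d : ℤ) ≤ 5 * k := by
    refine le_trans ?_ e12
    rw [← nsmul_eq_mul, ← Finset.sum_const]
    refine le_trans (Finset.sum_le_sum fun e he => ?_)
      (Finset.sum_le_sum_of_subset_of_nonneg (Finset.filter_subset _ _) fun e _ _ => hh0 e)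
    have h1 := (Finset.mem_filter.1 he).2
    have h2 := hle e
    simp only [hh]
    omega
  have e14 := Finset.card_filter_add_card_filter_not (s := S₁ \ S₂) fun e => p e < 2 * d
  have e15 : ((S₁ \ S₂).filter fun e => ¬ p e < 2 * d).card * d ≤ 5 * k := by exact_mod_cast e13
  rw [← e14, add_mul]
  linarith

/-- One scaling phase: `X` rounds of auction followed by `Y` augmentations. -/
noncomputable def phase (acc : Access Q A α) (k d X Y : ℕ) (w : α → ℤ) (δ : ℤ) (σ : Splitting α) :
    ParallelAlg Q A (Splitting α) :=
  (ParallelAlg.iter (auction acc k d w σ.w₁ δ) X fun _ => 0).bind fun p =>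
    (acc.bases (auctionWeight₁ σ.w₁ δ p) (auctionWeight₂ w σ.w₁ δ p)).bind fun B =>
      ParallelAlg.iter (augment acc) Y
        ⟨auctionWeight₁ σ.w₁ δ p, auctionWeight₂ w σ.w₁ δ p, B.1, B.2⟩

lemma phase_rounds (h : acc.Correct o M₁ M₂ t c) (X Y : ℕ) (σ : Splitting α) :
    (phase acc k d X Y w δ σ).rounds o ≤ X * t + (t + Y) := by
  simp only [phase, ParallelAlg.rounds_bind]
  gcongr
  · exact ParallelAlg.rounds_iter_le o (auction_rounds h k d w _ δ) _ _
  · exact h.bases_rounds _ _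
  · simpa using ParallelAlg.rounds_iter_le o (augment_rounds h) Y _

lemma phase_width (h : acc.Correct o M₁ M₂ t c) (X Y : ℕ) (σ : Splitting α) :
    (phase acc k d X Y w δ σ).width o ≤ c := by
  simp only [phase, ParallelAlg.width_bind]
  exact max_le (ParallelAlg.width_iter_le o (auction_width h k d w _ δ) _ _)
    (max_le (h.bases_width _ _) (ParallelAlg.width_iter_le o (augment_width h) Y _))

/-- Numbers of rounds that suffice for a scaling phase on `n` elements in rank `k`. -/
def PhaseParams (n k d X Y : ℕ) : Prop := k ≤ Y ∨ 2 * d ^ 2 * n < X * k ∧ 0 < d ∧ 6 * k ≤ Y * d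

/-- A common base that is optimal for a splitting of a weight function close to `w`. -/
structure Splitting.Close (M₁ M₂ : Matroid α) (w : α → ℤ) (δ : ℤ) (σ : Splitting α) : Prop where
  valid : σ.Valid M₁ M₂
  eq : σ.S₁ = σ.S₂
  le : ∀ e, |σ.w₁ e + σ.w₂ e - w e| ≤ δ

/-- Only `σ.w₁` is carried over, and the second weight restarts at `w - σ.w₁`. The auction makes the
sum `w` or `w + δ`, and augmentations preserve it. The old common base is both the reference for the
auction and the witness that augmentations exist. -/
lemma phase_output (h : acc.Correct o M₁ M₂ t c) (hE₁ : M₁.E = univ) (hE₂ : M₂.E = univ)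
    (hk₁ : ∀ B : Finset α, M₁.IsBase (B : Set α) → B.card = k)
    (hk₂ : ∀ B : Finset α, M₂.IsBase (B : Set α) → B.card = k) (hδ : 0 < δ) {X Y : ℕ}
    (hXY : PhaseParams (Fintype.card α) k d X Y) {σ τ : Splitting α}
    (hσ : σ.Close M₁ M₂ w (2 * δ)) (hτ : τ = (phase acc k d X Y w δ σ).output o) :
    τ.Close M₁ M₂ w δ ∧ ∀ e, w e ≤ τ.w₁ e + τ.w₂ e := by
  simp only [phase, ParallelAlg.output_bind, h.bases_output] at hτ
  set p := (ParallelAlg.iter (auction acc k d w σ.w₁ δ) X fun _ => 0).output o with hp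
  obtain ⟨hinv, hfin⟩ := auction_iter_output h hδ.le X hp
  have hS₂ : IsLocalMax M₂ σ.w₂ σ.S₁ := hσ.eq ▸ hσ.valid.2
  have hG₁ := greedyBase_isLocalMax hE₁ (auctionWeight₁ σ.w₁ δ p)
  have hG₂ := greedyBase_isLocalMax hE₂ (auctionWeight₂ w σ.w₁ δ p)
  obtain ⟨h1, h2, h3⟩ := augment_iter_output h hE₁ hE₂ (T := σ.S₁) hσ.valid.1.1 hS₂.1 Y
    (σ := ⟨auctionWeight₁ σ.w₁ δ p, auctionWeight₂ w σ.w₁ δ p,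
      greedyBase M₁ (auctionWeight₁ σ.w₁ δ p), greedyBase M₂ (auctionWeight₂ w σ.w₁ δ p)⟩) ⟨hG₁, hG₂⟩ hτ
  have hcard : (greedyBase M₁ (auctionWeight₁ σ.w₁ δ p) \
      greedyBase M₂ (auctionWeight₂ w σ.w₁ δ p)).card ≤ Y := by
    rcases hXY with hY | ⟨hX, hd, hY⟩
    · exact (Finset.card_le_card Finset.sdiff_subset).trans ((hk₁ _ hG₁.1).trans_le hY)
    · have hfew := hfin.resolve_right fun hcon => by
        have : ∑ e, p e ≤ Fintype.card α * (2 * d) := by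
          simpa using Finset.sum_le_sum fun e (_ : e ∈ Finset.univ) => hinv.le e
        have := Nat.mul_le_mul_left d this
        nlinarith
      have := hinv.card_sdiff_le hE₁ hE₂ hk₁ hk₂ hδ hσ.valid.1 hS₂ hσ.le hfew
      exact le_of_mul_le_mul_right (this.trans hY) hd
  have hsub : τ.S₁ ⊆ τ.S₂ := by
    rw [← Finset.sdiff_eq_empty_iff_subset, ← Finset.card_eq_zero]
    exact Nat.le_zero.1 (h3.trans (Nat.sub_eq_zero_of_le hcard).le)
  have hsum : ∀ e, τ.w₁ e + τ.w₂ e = w e ∨ τ.w₁ e + τ.w₂ e = w e + δ := fun e => by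
    rw [h2 e]
    simp only [auctionWeight₁, auctionWeight₂]
    have : (p e + 1) / 2 = p e / 2 ∨ (p e + 1) / 2 = p e / 2 + 1 := by omega
    rcases this with h | h <;> rw [h]
    · left; ring
    · right; push_cast; ring
  refine ⟨⟨h1, Finset.eq_of_subset_of_card_le hsub ?_, fun e => ?_⟩, fun e => ?_⟩
  · rw [hk₁ _ h1.1.1, hk₂ _ h1.2.1]
  · rcases hsum e with h | h <;> rw [h]
    · simpa using hδ.le
    · simp [abs_of_pos hδ]
  · rcases hsum e with h | h <;> rw [h]
    linarith

/-- Phases with precisions `2 ^ L, …, 2, 1`. -/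
noncomputable def scaling (acc : Access Q A α) (k d X Y : ℕ) (w : α → ℤ) :
    ℕ → Splitting α → ParallelAlg Q A (Splitting α)
  | 0, σ => phase acc k d X Y w 1 σ
  | L + 1, σ => (phase acc k d X Y w (2 ^ (L + 1)) σ).bind (scaling acc k d X Y w L)

lemma scaling_rounds (h : acc.Correct o M₁ M₂ t c) (X Y L : ℕ) (σ : Splitting α) :
    (scaling acc k d X Y w L σ).rounds o ≤ (L + 1) * (X * t + (t + Y)) := by
  induction L generalizing σ with
  | zero => simpa [scaling] using phase_rounds h X Y σ
  | succ L ih =>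
    simp only [scaling, ParallelAlg.rounds_bind]
    have h1 := phase_rounds (k := k) (d := d) (w := w) (δ := 2 ^ (L + 1)) h X Y σ
    have h2 := ih ((phase acc k d X Y w (2 ^ (L + 1)) σ).output o)
    rw [add_mul (L + 1) 1]
    linarith

lemma scaling_width (h : acc.Correct o M₁ M₂ t c) (X Y L : ℕ) (σ : Splitting α) :
    (scaling acc k d X Y w L σ).width o ≤ c := by
  induction L generalizing σ with
  | zero => exact phase_width h X Y σ
  | succ L ih =>
    simp only [scaling, ParallelAlg.width_bind]
    exact max_le (phase_width h X Y σ) (ih _)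

lemma scaling_output (h : acc.Correct o M₁ M₂ t c) (hE₁ : M₁.E = univ) (hE₂ : M₂.E = univ)
    (hk₁ : ∀ B : Finset α, M₁.IsBase (B : Set α) → B.card = k)
    (hk₂ : ∀ B : Finset α, M₂.IsBase (B : Set α) → B.card = k) {X Y : ℕ}
    (hXY : PhaseParams (Fintype.card α) k d X Y) (L : ℕ) {σ τ : Splitting α}
    (hσ : σ.Close M₁ M₂ w (2 * 2 ^ L)) (hτ : τ = (scaling acc k d X Y w L σ).output o) :
    τ.Close M₁ M₂ w 1 ∧ ∀ e, w e ≤ τ.w₁ e + τ.w₂ e := by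
  induction L generalizing σ with
  | zero => exact phase_output h hE₁ hE₂ hk₁ hk₂ one_pos hXY (by simpa using hσ) hτ
  | succ L ih =>
    simp only [scaling, ParallelAlg.output_bind] at hτ
    refine ih ?_ hτ
    have := (phase_output h hE₁ hE₂ hk₁ hk₂ (by positivity) hXY hσ rfl).1
    rwa [← pow_succ' (2 : ℤ) L]

/-- A common base of maximum weight, starting from the common base `D`. -/
noncomputable def maxWeightBase (acc : Access Q A α) (k d X Y L : ℕ) (w : α → ℤ) (D : Finset α) :
    ParallelAlg Q A (Finset α) :=
  (scaling acc k d X Y (fun e => (k + 1) * w e) L ⟨fun _ => 0, fun _ => 0, D, D⟩).bind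
    fun σ => .done σ.S₁

lemma maxWeightBase_rounds (h : acc.Correct o M₁ M₂ t c) (X Y L : ℕ) (D : Finset α) :
    (maxWeightBase acc k d X Y L w D).rounds o ≤ (L + 1) * (X * t + (t + Y)) := by
  simpa [maxWeightBase] using scaling_rounds h X Y L _

lemma maxWeightBase_width (h : acc.Correct o M₁ M₂ t c) (X Y L : ℕ) (D : Finset α) :
    (maxWeightBase acc k d X Y L w D).width o ≤ c := by
  simpa [maxWeightBase] using scaling_width h X Y L _

/-- An error between `0` and `1` per element costs at most `k` on a base, less than the gap `k + 1`
between distinct scaled weights. The hypothesis `hL` makes the zero splitting an admissible start.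
-/
lemma maxWeightBase_output (h : acc.Correct o M₁ M₂ t c) (hE₁ : M₁.E = univ) (hE₂ : M₂.E = univ)
    (hk₁ : ∀ B : Finset α, M₁.IsBase (B : Set α) → B.card = k)
    (hk₂ : ∀ B : Finset α, M₂.IsBase (B : Set α) → B.card = k) {X Y : ℕ}
    (hXY : PhaseParams (Fintype.card α) k d X Y) {L : ℕ} {D S : Finset α}
    (hD₁ : M₁.IsBase (D : Set α)) (hD₂ : M₂.IsBase (D : Set α))
    (hL : ∀ e, (k + 1) * |w e| ≤ 2 * 2 ^ L)
    (hS : S = (maxWeightBase acc k d X Y L w D).output o) :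
    M₁.IsBase (S : Set α) ∧ M₂.IsBase (S : Set α) ∧
      ∀ T : Finset α, M₁.IsBase (T : Set α) → M₂.IsBase (T : Set α) →
        ∑ e ∈ T, w e ≤ ∑ e ∈ S, w e := by
  simp only [maxWeightBase, ParallelAlg.output_bind, ParallelAlg.output_done] at hS
  obtain ⟨hτ, hle⟩ := scaling_output (w := fun e => (k + 1) * w e) h hE₁ hE₂ hk₁ hk₂ hXY L
    (σ := ⟨fun _ => 0, fun _ => 0, D, D⟩)
    ⟨⟨⟨hD₁, by simp⟩, ⟨hD₂, by simp⟩⟩, rfl, fun e => by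
      have h0 : (0 : ℤ) ≤ k + 1 := by positivity
      simpa [abs_mul, abs_of_nonneg h0] using hL e⟩ rfl
  generalize (scaling acc k d X Y (fun e => (k + 1) * w e) L ⟨fun _ => 0, fun _ => 0, D, D⟩).output
    o = τ at hS hτ hle
  subst hS
  have hv₂ : IsLocalMax M₂ τ.w₂ τ.S₁ := hτ.eq ▸ hτ.valid.2
  refine ⟨hτ.valid.1.1, hv₂.1, fun T hT₁ hT₂ => ?_⟩
  have h1 := hτ.valid.1.sum_le hE₁ hT₁
  have h2 := hv₂.sum_le hE₂ hT₂
  have h3 : ∑ e ∈ T, (k + 1) * w e ≤ ∑ e ∈ T, (τ.w₁ e + τ.w₂ e) :=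
    Finset.sum_le_sum fun e _ => hle e
  have h4 : ∑ e ∈ τ.S₁, (τ.w₁ e + τ.w₂ e) ≤ ∑ e ∈ τ.S₁, ((k + 1) * w e + 1) :=
    Finset.sum_le_sum fun e _ => by have := (abs_le.1 (hτ.le e)).2; linarith
  rw [Finset.sum_add_distrib] at h3 h4
  rw [Finset.sum_add_distrib, Finset.sum_const, hk₁ _ hτ.valid.1.1, ← Finset.mul_sum] at h4
  rw [← Finset.mul_sum] at h3
  simp only [nsmul_eq_mul, mul_one] at h4
  have h5 : ((k : ℤ) + 1) * (∑ e ∈ T, w e) < (k + 1) * (∑ e ∈ τ.S₁, w e + 1) := by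
    linarith
  have := lt_of_mul_lt_mul_left h5 (by positivity)
  omega

end Algorithm

/-! ### Greedy bases from ranks, exchanges from independence -/

section Rank

variable {α : Type} [Fintype α] [DecidableEq α] {M M₁ M₂ : Matroid α}

/-- The rank as a natural number. -/
noncomputable def natRank (M : Matroid α) (X : Finset α) : ℕ := (M.eRk (X : Set α)).toNat

lemma coe_natRank (M : Matroid α) (X : Finset α) : (natRank M X : ℕ∞) = M.eRk (X : Set α) :=
  ENat.natCast_toNat
    (ne_top_of_le_ne_top (by simp) (M.eRk_le_encard (X : Set α)))

lemma indep_iff_natRank {X : Finset α} : M.Indep (X : Set α) ↔ natRank M X = X.card := by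
  rw [Matroid.indep_iff_eRk_eq_encard_of_finite (Finset.finite_toSet X), ← coe_natRank,
    Set.encard_coe_eq_coe_finsetCard, Nat.cast_inj]

lemma mem_closure_iff_natRank (hE : M.E = univ) {X : Finset α} {e : α} :
    e ∈ M.closure (X : Set α) ↔ natRank M (insert e X) = natRank M X := by
  rw [← Nat.cast_inj (R := ℕ∞), coe_natRank, coe_natRank]
  push_cast
  constructor
  · intro h
    rw [← M.eRk_closure_eq, Matroid.closure_insert_eq_of_mem_closure h, M.eRk_closure_eq]
  · intro h
    by_contra hcon
    rw [Matroid.eRk_insert_eq_add_one ⟨by simp [hE], hcon⟩, ← coe_natRank] at h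
    have : natRank M X + 1 = natRank M X := by exact_mod_cast h
    omega

lemma notMem_closure_iff_indep (hE : M.E = univ) {X : Finset α} (hX : M.Indep (X : Set α)) {e : α} :
    e ∉ M.closure (X : Set α) ↔ e ∉ X ∧ M.Indep ((insert e X : Finset α) : Set α) := by
  rw [hX.notMem_closure_iff (by simp [hE]), and_comm]
  push_cast
  rfl

/-- The rank in the matroid that is named by the query. -/
noncomputable def sideRank (M₁ M₂ : Matroid α) : Finset α ⊕ Finset α → ℕ :=
  Sum.elim (natRank M₁) (natRank M₂)

/-- Independence in the matroid that is named by the query. -/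
def sideIndep (M₁ M₂ : Matroid α) : Finset α ⊕ Finset α → Prop :=
  Sum.elim (fun X => M₁.Indep (X : Set α)) fun X => M₂.Indep (X : Set α)

open Classical in
/-- The sets whose ranks determine the greedy bases. -/
noncomputable def greedyQuery (w₁ w₂ : α → ℤ) : (α ⊕ α) × Bool → Finset α ⊕ Finset α
  | (Sum.inl e, b) => Sum.inl <| cond b (insert e (earlier w₁ e).toFinset) (earlier w₁ e).toFinset
  | (Sum.inr e, b) => Sum.inr <| cond b (insert e (earlier w₂ e).toFinset) (earlier w₂ e).toFinset

/-- The sets whose independence determines the possible exchanges. -/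
def exchangeQuery (S₁ S₂ : Finset α) : (α × α) ⊕ (α × α) → Finset α ⊕ Finset α
  | Sum.inl (a, b) => Sum.inl (insert b (S₁.erase a))
  | Sum.inr (a, b) => Sum.inr (insert b (S₂.erase a))

variable {Q A : Type}

/-- Access from procedures for ranks and for independence. -/
noncomputable def accessOf
    (ranks : ((α ⊕ α) × Bool → Finset α ⊕ Finset α) → ParallelAlg Q A ((α ⊕ α) × Bool → ℕ))
    (indeps : ((α × α) ⊕ (α × α) → Finset α ⊕ Finset α) →
      ParallelAlg Q A ((α × α) ⊕ (α × α) → Prop)) : Access Q A α where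
  bases w₁ w₂ := (ranks (greedyQuery w₁ w₂)).bind fun a => .done
    (Finset.univ.filter fun e => a (Sum.inl e, true) ≠ a (Sum.inl e, false),
      Finset.univ.filter fun e => a (Sum.inr e, true) ≠ a (Sum.inr e, false))
  exchanges S₁ S₂ := (indeps (exchangeQuery S₁ S₂)).bind fun a => .done
    (fun x y => y ∉ S₁.erase x ∧ a (Sum.inl (x, y)), fun x y => y ∉ S₂.erase x ∧ a (Sum.inr (x, y)))

lemma accessOf_correct (hE₁ : M₁.E = univ) (hE₂ : M₂.E = univ) {o : Q → A} {t c : ℕ}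
    {ranks : ((α ⊕ α) × Bool → Finset α ⊕ Finset α) → ParallelAlg Q A ((α ⊕ α) × Bool → ℕ)}
    {indeps : ((α × α) ⊕ (α × α) → Finset α ⊕ Finset α) →
      ParallelAlg Q A ((α × α) ⊕ (α × α) → Prop)}
    (hr : ∀ q, (ranks q).output o = fun i => sideRank M₁ M₂ (q i))
    (hr' : ∀ q, (ranks q).rounds o ≤ t) (hr'' : ∀ q, (ranks q).width o ≤ c)
    (hi : ∀ q, (indeps q).output o = fun i => sideIndep M₁ M₂ (q i))
    (hi' : ∀ q, (indeps q).rounds o ≤ 1) (hi'' : ∀ q, (indeps q).width o ≤ c) :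
    (accessOf ranks indeps).Correct o M₁ M₂ t c where
  bases_output w₁ w₂ := by
    simp only [accessOf, ParallelAlg.output_bind, ParallelAlg.output_done, hr, Prod.mk.injEq]
    constructor
    · ext e
      rw [Finset.mem_filter]
      simp only [Finset.mem_univ, true_and, mem_greedyBase, greedyQuery, sideRank, Sum.elim_inl,
        cond_true, cond_false, ne_eq]
      rw [← mem_closure_iff_natRank hE₁, Set.coe_toFinset]
    · ext e
      rw [Finset.mem_filter]
      simp only [Finset.mem_univ, true_and, mem_greedyBase, greedyQuery, sideRank, Sum.elim_inr,
        cond_true, cond_false, ne_eq]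
      rw [← mem_closure_iff_natRank hE₂, Set.coe_toFinset]
  bases_rounds w₁ w₂ := by simpa [accessOf] using hr' _
  bases_width w₁ w₂ := by simpa [accessOf] using hr'' _
  exchanges_fst S₁ S₂ h₁ h₂ a b := by
    simp only [accessOf, ParallelAlg.output_bind, ParallelAlg.output_done, hi]
    rw [← Finset.coe_erase, notMem_closure_iff_indep hE₁
      (h₁.indep.subset (by simp))]
    rfl
  exchanges_snd S₁ S₂ h₁ h₂ a b := by
    simp only [accessOf, ParallelAlg.output_bind, ParallelAlg.output_done, hi]
    rw [← Finset.coe_erase, notMem_closure_iff_indep hE₂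
      (h₂.indep.subset (by simp))]
    rfl
  exchanges_rounds S₁ S₂ := by simpa [accessOf] using hi' _
  exchanges_width S₁ S₂ := by simpa [accessOf] using hi'' _

end Rank

/-! ### Free extension and truncation -/

section Padding

variable {n : ℕ}

/-- The matroid `M` extended by `k` free elements and truncated to rank `k`. -/
def pad (M : Matroid (Fin n)) (k : ℕ) : Matroid (Fin n ⊕ Fin k) :=
  (IndepMatroid.ofFinset univ (fun I => M.Indep (I.toLeft : Set (Fin n)) ∧ I.card ≤ k)
    (by
      have : (∅ : Finset (Fin n ⊕ Fin k)).toLeft = ∅ := by ext; simp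
      simp [this])
    (fun I J hJ hIJ => ⟨hJ.1.subset (by exact_mod_cast Finset.toLeft_subset_toLeft hIJ),
      (Finset.card_le_card hIJ).trans hJ.2⟩)
    (fun I J hI hJ hIJ => by
      by_cases h : ∃ y ∈ J.toRight, y ∉ I.toRight
      · obtain ⟨y, hyJ, hyI⟩ := h
        rw [Finset.mem_toRight] at hyJ hyI
        refine ⟨Sum.inr y, hyJ, hyI, by simpa using hI.1, ?_⟩
        rw [Finset.card_insert_of_notMem hyI]
        have := hJ.2
        omega
      -- All free elements of `J` lie in `I`, so `I` has fewer elements of the original ground set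
      -- and `M` itself augments.
      · push Not at h
        have h1 : J.toRight.card ≤ I.toRight.card := Finset.card_le_card h
        have h2 := Finset.card_toLeft_add_card_toRight (u := I)
        have h3 := Finset.card_toLeft_add_card_toRight (u := J)
        obtain ⟨x, ⟨hxJ, hxI⟩, hx⟩ := hI.1.augment hJ.1 (by
          rw [Set.encard_coe_eq_coe_finsetCard, Set.encard_coe_eq_coe_finsetCard]
          exact_mod_cast (by omega : I.toLeft.card < J.toLeft.card))
        have hxJ : Sum.inl x ∈ J := by simpa using hxJ
        have hxI : Sum.inl x ∉ I := by simpa using hxI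
        refine ⟨Sum.inl x, hxJ, hxI, by simpa using hx, ?_⟩
        rw [Finset.card_insert_of_notMem hxI]
        have := hJ.2
        omega)
    (fun _ _ => subset_univ _)).matroid

variable {M M₁ M₂ : Matroid (Fin n)} {k : ℕ}

lemma pad_ground : (pad M k).E = univ := rfl

lemma pad_indep {I : Finset (Fin n ⊕ Fin k)} :
    (pad M k).Indep (I : Set (Fin n ⊕ Fin k)) ↔ M.Indep (I.toLeft : Set (Fin n)) ∧ I.card ≤ k := by
  simp only [pad, IndepMatroid.matroid_Indep, IndepMatroid.ofFinset_indep]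

/-- The set of all added elements. -/
def padBase (n k : ℕ) : Finset (Fin n ⊕ Fin k) := Finset.univ.filter fun e => e.isRight

lemma toLeft_padBase : (padBase n k).toLeft = ∅ := by
  ext x; simp [padBase]

lemma card_padBase : (padBase n k).card = k := by
  rw [← Finset.card_toLeft_add_card_toRight, toLeft_padBase]
  have : (padBase n k).toRight = Finset.univ := by ext x; simp [padBase]
  simp [this]

lemma pad_isBase_iff {B : Finset (Fin n ⊕ Fin k)} :
    (pad M k).IsBase (B : Set (Fin n ⊕ Fin k)) ↔ M.Indep (B.toLeft : Set (Fin n)) ∧ B.card = k := by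
  constructor
  · intro hB
    obtain ⟨h1, h2⟩ := pad_indep.1 hB.indep
    refine ⟨h1, h2.antisymm ?_⟩
    by_contra hlt
    have hD : (pad M k).Indep (padBase n k : Set (Fin n ⊕ Fin k)) := by
      rw [pad_indep, toLeft_padBase, card_padBase]
      simp
    obtain ⟨e, he, hi⟩ := hB.indep.augment hD (by
      rw [Set.encard_coe_eq_coe_finsetCard, Set.encard_coe_eq_coe_finsetCard, card_padBase]
      exact_mod_cast not_le.1 hlt)
    exact he.2 (hB.mem_of_insert_indep hi)
  · rintro ⟨h1, h2⟩
    obtain ⟨B', hB', hsub⟩ := (pad_indep.2 ⟨h1, h2.le⟩).exists_isBase_superset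
    have hfin : B'.Finite := Set.toFinite _
    lift B' to Finset (Fin n ⊕ Fin k) using hfin
    have : B = B' := Finset.eq_of_subset_of_card_le (by exact_mod_cast hsub)
      (by rw [h2]; exact (pad_indep.1 hB'.indep).2)
    exact this ▸ hB'

/-- Free elements add their number to the rank and truncation caps it. Hence one rank query to `M`
answers one to the padded matroid. -/
lemma natRank_pad (hE : M.E = univ) (X : Finset (Fin n ⊕ Fin k)) :
    natRank (pad M k) X = min k (natRank M X.toLeft + X.toRight.card) := by
  apply le_antisymm
  · rw [← Nat.cast_le (α := ℕ∞), coe_natRank, Matroid.eRk_le_iff]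
    intro J hJX hJ
    have hfin : J.Finite := Set.toFinite _
    lift J to Finset (Fin n ⊕ Fin k) using hfin
    rw [pad_indep] at hJ
    rw [Set.encard_coe_eq_coe_finsetCard, Nat.cast_le]
    have hJX : J ⊆ X := by exact_mod_cast hJX
    refine le_min hJ.2 ?_
    rw [← Finset.card_toLeft_add_card_toRight]
    gcongr
    rw [← Nat.cast_le (α := ℕ∞), coe_natRank, ← Set.encard_coe_eq_coe_finsetCard]
    exact hJ.1.encard_le_eRk_of_subset (by exact_mod_cast Finset.toLeft_subset_toLeft hJX)
  · obtain ⟨I, hI⟩ := M.exists_isBasis (X.toLeft : Set (Fin n)) (by simp [hE])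
    have hfin : I.Finite := Set.toFinite _
    lift I to Finset (Fin n) using hfin
    have hIc : natRank M X.toLeft = I.card := by
      rw [← Nat.cast_inj (R := ℕ∞), coe_natRank, hI.eRk_eq_encard, Set.encard_coe_eq_coe_finsetCard]
    obtain ⟨Z, hZ, hZc⟩ := Finset.exists_subset_card_eq
      (s := I.disjSum X.toRight) (n := min k (natRank M X.toLeft + X.toRight.card)) (by
        rw [Finset.card_disjSum, hIc]; exact min_le_right _ _)
    rw [← hZc, ← Nat.cast_le (α := ℕ∞), coe_natRank, ← Set.encard_coe_eq_coe_finsetCard]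
    apply Matroid.Indep.encard_le_eRk_of_subset
    · rw [pad_indep]
      refine ⟨hI.indep.subset ?_, hZc.trans_le (min_le_left _ _)⟩
      intro x hx
      have := hZ (by simpa using hx : Sum.inl x ∈ Z)
      simpa using this
    · intro x hx
      have hx := hZ hx
      have hIX : I ⊆ X.toLeft := by exact_mod_cast hI.subset
      rw [Finset.mem_disjSum] at hx
      rcases hx with ⟨y, hy, rfl⟩ | ⟨y, hy, rfl⟩
      · simpa using hIX hy
      · simpa using hy

/-- A common independent set of maximum weight among those with at most `k` elements comes from a
common base of maximum weight of the padded matroids. -/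
lemma exists_pad_isBase {T : Finset (Fin n)} (hT : CommonIndep M₁ M₂ T) (hTk : T.card ≤ k) :
    ∃ B : Finset (Fin n ⊕ Fin k), B.toLeft = T ∧ (pad M₁ k).IsBase (B : Set (Fin n ⊕ Fin k)) ∧
      (pad M₂ k).IsBase (B : Set (Fin n ⊕ Fin k)) := by
  obtain ⟨Z, -, hZ⟩ := Finset.exists_subset_card_eq (s := (Finset.univ : Finset (Fin k)))
    (n := k - T.card) (by simp)
  have h1 : (T.disjSum Z).toLeft = T := by ext x; simp
  have h2 : (T.disjSum Z).card = k := by rw [Finset.card_disjSum, hZ]; omega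
  exact ⟨T.disjSum Z, h1, pad_isBase_iff.2 ⟨by rw [h1]; exact hT.1, h2⟩,
    pad_isBase_iff.2 ⟨by rw [h1]; exact hT.2, h2⟩⟩

end Padding

/-! ### One round of the block-wise basis search -/

section Blocks

variable {α : Type} [DecidableEq α] {s : ℕ} {R : Finset α}

/-- The position of `x` in an enumeration of `R`. -/
noncomputable def position (R : Finset α) (x : α) : ℕ :=
  if h : x ∈ R then (R.equivFin ⟨x, h⟩ : ℕ) else 0

lemma position_injOn : Set.InjOn (position R) R := by
  intro x hx y hy h
  have hx : x ∈ R := hx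
  have hy : y ∈ R := hy
  simp only [position, hx, hy, dif_pos] at h
  simpa using R.equivFin.injective (Fin.ext h)

lemma exists_position {j : ℕ} (hj : j < R.card) : ∃ x ∈ R, position R x = j :=
  ⟨R.equivFin.symm ⟨j, hj⟩, (R.equivFin.symm ⟨j, hj⟩).2, by simp [position]⟩

/-- The `j`-th block of `s` consecutive elements. -/
noncomputable def block (s : ℕ) (R : Finset α) (j : ℕ) : Finset α :=
  R.filter fun x => position R x / s = j

/-- The part of the block of `x` up to `x`. -/
noncomputable def blockUpTo (s : ℕ) (R : Finset α) (x : α) : Finset α :=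
  R.filter fun y => position R y / s = position R x / s ∧ position R y ≤ position R x

/-- The part of the block of `x` before `x`. -/
noncomputable def blockBefore (s : ℕ) (R : Finset α) (x : α) : Finset α :=
  R.filter fun y => position R y / s = position R x / s ∧ position R y < position R x

lemma blockUpTo_eq_insert {x : α} (hx : x ∈ R) :
    blockUpTo s R x = insert x (blockBefore s R x) := by
  ext y
  simp only [blockUpTo, blockBefore, Finset.mem_filter, Finset.mem_insert]
  constructor
  · rintro ⟨h1, h2, h3⟩
    rcases h3.lt_or_eq with h | h
    · exact Or.inr ⟨h1, h2, h⟩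
    · exact Or.inl (position_injOn h1 hx h)
  · rintro (rfl | ⟨h1, h2, h3⟩)
    · exact ⟨hx, rfl, le_rfl⟩
    · exact ⟨h1, h2, h3.le⟩

/-- The segment before `x`, if nonempty, is the segment up to its last element, so its independence
is among the tests already made. -/
lemma blockBefore_eq {x : α} (h : (blockBefore s R x).Nonempty) :
    ∃ y ∈ blockBefore s R x, blockBefore s R x = blockUpTo s R y := by
  obtain ⟨y, hy, hmax⟩ := Finset.exists_max_image _ (position R) h
  refine ⟨y, hy, ?_⟩
  have hy' := hy
  simp only [blockBefore, Finset.mem_filter] at hy'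
  ext z
  constructor
  · intro hz
    have h1 := hmax z hz
    simp only [blockBefore, blockUpTo, Finset.mem_filter] at hz ⊢
    exact ⟨hz.1, hz.2.1.trans hy'.2.1.symm, h1⟩
  · intro hz
    simp only [blockBefore, blockUpTo, Finset.mem_filter] at hz ⊢
    exact ⟨hz.1, hz.2.1.trans hy'.2.1, hz.2.2.trans_lt hy'.2.2⟩

lemma card_block {j : ℕ} (hs : 0 < s) (hj : (j + 1) * s ≤ R.card) : (block s R j).card = s := by
  have hinj : Set.InjOn (position R) (block s R j : Set α) :=
    position_injOn.mono fun x hx => (Finset.mem_filter.1 hx).1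
  rw [← Finset.card_image_of_injOn hinj]
  have : (block s R j).image (position R) = Finset.Ico (j * s) ((j + 1) * s) := by
    ext i
    simp only [block, Finset.mem_image, Finset.mem_filter, Finset.mem_Ico]
    have hdiv : ∀ i, i / s = j ↔ j * s ≤ i ∧ i < (j + 1) * s := fun i => by
      rw [Nat.div_eq_iff hs]
      constructor
      · rintro ⟨h1, h2⟩
        refine ⟨h1, ?_⟩
        rw [add_mul]
        omega
      · rintro ⟨h1, h2⟩
        rw [add_mul] at h2
        exact ⟨h1, by omega⟩
    constructor
    · rintro ⟨x, ⟨-, hx⟩, rfl⟩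
      exact (hdiv _).1 hx
    · intro hi
      obtain ⟨x, hx, rfl⟩ := exists_position (R := R) (j := i) (by omega)
      exact ⟨x, ⟨hx, (hdiv _).2 hi⟩, rfl⟩
  rw [this, Nat.card_Ico, add_mul]
  omega

lemma block_last {j : ℕ} (hs : 0 < s) (hj : (j + 1) * s ≤ R.card) :
    ∃ x ∈ R, blockUpTo s R x = block s R j ∧ x ∈ block s R j := by
  have hne : (block s R j).Nonempty := by
    rw [← Finset.card_pos, card_block hs hj]; exact hs
  obtain ⟨x, hx, hmax⟩ := Finset.exists_max_image _ (position R) hne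
  have hx' := hx
  simp only [block, Finset.mem_filter] at hx'
  refine ⟨x, hx'.1, ?_, hx⟩
  ext y
  constructor
  · intro hy
    simp only [block, blockUpTo, Finset.mem_filter] at hy ⊢
    exact ⟨hy.1, hy.2.1.trans hx'.2⟩
  · intro hy
    have h1 := hmax y hy
    simp only [block, blockUpTo, Finset.mem_filter] at hy ⊢
    exact ⟨hy.1, hy.2.trans hx'.2.symm, h1⟩

open Classical in
/-- Add a full block all of whose elements pass the test to `I`, if there is one, and otherwise drop
from `R` the first element of each block that fails the test. -/
noncomputable def basisStep (s : ℕ) (ok : α → Prop) (I R : Finset α) : Finset α × Finset α :=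
  if h : ∃ j, (j + 1) * s ≤ R.card ∧ ∀ x ∈ block s R j, ok x then
    (I ∪ block s R h.choose, R \ block s R h.choose)
  else (I, R.filter fun x => ok x ∨ ∃ y ∈ blockBefore s R x, ¬ ok y)

/-- `I` is independent and can be extended by elements of `R` to a basis of `X`. -/
structure IsPartialBasis (M : Matroid α) (X I R : Finset α) : Prop where
  indep : M.Indep (I : Set α)
  disj : Disjoint I R
  closure : M.closure ((I ∪ R : Finset α) : Set α) = M.closure (X : Set α)

/-- Either a whole block is independent over `I`, or each full block has a first failing element,
which is spanned by `I` and its predecessors in the block. These predecessors pass and are kept, so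
all first failures can be dropped at once without changing the closure. -/
lemma IsPartialBasis.basisStep {M : Matroid α} (hE : M.E = univ) {X I : Finset α}
    (h : IsPartialBasis M X I R) (hs : 0 < s) {ok : α → Prop}
    (hok : ∀ x, ok x ↔ M.Indep ((I ∪ blockUpTo s R x : Finset α) : Set α)) :
    IsPartialBasis M X (basisStep s ok I R).1 (basisStep s ok I R).2 ∧
      ((basisStep s ok I R).1.card = I.card + s ∧ (basisStep s ok I R).2.card + s ≤ R.card ∨
        (basisStep s ok I R).1 = I ∧ (basisStep s ok I R).2.card + R.card / s ≤ R.card) := by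
  classical
  rw [MatroidIntersection.basisStep]
  split_ifs with hex
  · obtain ⟨hj, hblock⟩ := hex.choose_spec
    set j := hex.choose
    have hsub : block s R j ⊆ R := Finset.filter_subset _ _
    obtain ⟨x, hxR, hx, hxj⟩ := block_last hs hj
    refine ⟨⟨?_, ?_, ?_⟩, Or.inl ⟨?_, ?_⟩⟩
    · rw [← hx]
      exact (hok x).1 (hblock x hxj)
    · rw [Finset.disjoint_union_left]
      exact ⟨h.disj.mono_right Finset.sdiff_subset, Finset.disjoint_sdiff⟩
    · rw [Finset.union_assoc, Finset.union_sdiff_of_subset hsub]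
      exact h.closure
    · rw [Finset.card_union_of_disjoint (h.disj.mono_right hsub), card_block hs hj]
    · rw [Finset.card_sdiff_of_subset hsub, card_block hs hj]
      have := Finset.card_le_card hsub
      rw [card_block hs hj] at this
      omega
  · set R' := R.filter fun x => ok x ∨ ∃ y ∈ blockBefore s R x, ¬ ok y with hR'
    have hR'R : R' ⊆ R := Finset.filter_subset _ _
    have hdrop : ∀ x ∈ R, x ∉ R' → ¬ ok x ∧ ∀ y ∈ blockBefore s R x, ok y := by
      intro x hx hx'
      simp only [hR', Finset.mem_filter, not_and, not_or, not_exists, not_not] at hx'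
      exact hx' hx
    have hbefore : ∀ x ∈ R, x ∉ R' → blockBefore s R x ⊆ R' := by
      intro x hx hx' y hy
      simp only [hR', Finset.mem_filter]
      refine ⟨?_, Or.inl ((hdrop x hx hx').2 y hy)⟩
      simp only [blockBefore, Finset.mem_filter] at hy
      exact hy.1
    refine ⟨⟨h.indep, h.disj.mono_right hR'R, ?_⟩, Or.inr ⟨rfl, ?_⟩⟩
    · rw [← h.closure]
      refine (M.closure_subset_closure (by
        exact_mod_cast Finset.union_subset_union_right hR'R)).antisymm
        (M.closure_subset_closure_of_subset_closure fun x hx => ?_)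
      by_cases hx' : x ∈ I ∪ R'
      · exact M.mem_closure_of_mem' (by exact_mod_cast hx') (by simp [hE])
      · have hxI : x ∉ I := fun h => hx' (Finset.mem_union_left _ h)
        have hxR' : x ∉ R' := fun h => hx' (Finset.mem_union_right _ h)
        have hxR : x ∈ R := by
          rcases Finset.mem_union.1 (Finset.mem_coe.1 hx) with h | h
          · exact absurd h hxI
          · exact h
        obtain ⟨h1, h2⟩ := hdrop x hxR hxR'
        have hind : M.Indep ((I ∪ blockBefore s R x : Finset α) : Set α) := by
          rcases (blockBefore s R x).eq_empty_or_nonempty with h0 | h0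
          · rw [h0, Finset.union_empty]; exact h.indep
          · obtain ⟨y, hy, hyeq⟩ := blockBefore_eq h0
            rw [hyeq]
            exact (hok y).1 (h2 y hy)
        have hxcl : x ∈ M.closure ((I ∪ blockBefore s R x : Finset α) : Set α) := by
          by_contra hcon
          rw [hind.notMem_closure_iff (by simp [hE])] at hcon
          refine h1 ((hok x).2 ?_)
          rw [blockUpTo_eq_insert hxR, Finset.union_insert, Finset.coe_insert]
          exact hcon.1
        exact M.closure_subset_closure (by
          exact_mod_cast Finset.union_subset_union_right (hbefore x hxR hxR')) hxcl
    · push Not at hex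
      have hfail : ∀ j < R.card / s, ∃ x ∈ R \ R', position R x / s = j := by
        intro j hj
        have hj' : (j + 1) * s ≤ R.card := (Nat.le_div_iff_mul_le hs).1 hj
        have hne : ((block s R j).filter fun x => ¬ ok x).Nonempty := by
          obtain ⟨x, hx, hx'⟩ := hex j hj'
          exact ⟨x, Finset.mem_filter.2 ⟨hx, hx'⟩⟩
        obtain ⟨x, hx, hmin⟩ := Finset.exists_min_image _ (position R) hne
        obtain ⟨hxb, hxok⟩ := Finset.mem_filter.1 hx
        have hxb' := hxb
        simp only [block, Finset.mem_filter] at hxb'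
        refine ⟨x, Finset.mem_sdiff.2 ⟨hxb'.1, fun hxR' => ?_⟩, hxb'.2⟩
        rcases (Finset.mem_filter.1 hxR').2 with h1 | ⟨y, hy, hyok⟩
        · exact hxok h1
        · simp only [blockBefore, Finset.mem_filter] at hy
          have := hmin y (Finset.mem_filter.2
            ⟨Finset.mem_filter.2 ⟨hy.1, hy.2.1.trans hxb'.2⟩, hyok⟩)
          omega
      have hcard : R.card / s ≤ (R \ R').card := by
        have hsub : Finset.range (R.card / s) ⊆ (R \ R').image fun x => position R x / s := by
          intro j hj
          obtain ⟨x, hx, hxj⟩ := hfail j (Finset.mem_range.1 hj)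
          exact Finset.mem_image.2 ⟨x, hx, hxj⟩
        simpa using (Finset.card_le_card hsub).trans Finset.card_image_le
      rw [Finset.card_sdiff_of_subset hR'R] at hcard
      have := Finset.card_le_card hR'R
      change R'.card + R.card / s ≤ R.card
      omega

end Blocks

/-! ### Number of rounds of the basis search -/

section BasisSearch

variable {α : Type} [DecidableEq α] {M : Matroid α} {k : ℕ}

/-- The block size in rank `k` when `m` elements remain. -/
def blockSize (k m : ℕ) : ℕ := if 2 * k < m then Nat.sqrt k else Nat.sqrt m

/-- One round of the parallel search for a basis. -/
noncomputable def basisUpdate (M : Matroid α) (k : ℕ) (p : Finset α × Finset α) :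
    Finset α × Finset α :=
  basisStep (blockSize k p.2.card)
    (fun x => M.Indep ((p.1 ∪ blockUpTo (blockSize k p.2.card) p.2 x : Finset α) : Set α)) p.1 p.2

lemma blockSize_pos (hk : 0 < k) {m : ℕ} (hm : 0 < m) : 0 < blockSize k m := by
  unfold blockSize
  split_ifs
  · exact Nat.sqrt_pos.2 hk
  · exact Nat.sqrt_pos.2 hm

/-- The block size is `0` when nothing remains, which `IsPartialBasis.basisStep` excludes; the
finished state is a fixed point, so surplus rounds are harmless. -/
lemma basisUpdate_empty (I : Finset α) : basisUpdate M k (I, ∅) = (I, ∅) := by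
  classical
  unfold basisUpdate basisStep
  split_ifs
  · simp [block]
  · exact Prod.ext rfl (Finset.filter_empty _)

lemma basisUpdate_spec (hE : M.E = univ) (hk : 0 < k) {X : Finset α} {p : Finset α × Finset α}
    (h : IsPartialBasis M X p.1 p.2) (hp : p.2.Nonempty) :
    IsPartialBasis M X (basisUpdate M k p).1 (basisUpdate M k p).2 ∧
      ((basisUpdate M k p).1.card = p.1.card + blockSize k p.2.card ∧
          (basisUpdate M k p).2.card + blockSize k p.2.card ≤ p.2.card ∨
        (basisUpdate M k p).1 = p.1 ∧
          (basisUpdate M k p).2.card + p.2.card / blockSize k p.2.card ≤ p.2.card) :=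
  h.basisStep hE (blockSize_pos hk (Finset.card_pos.2 hp)) fun _ => Iff.rfl

lemma basisUpdate_isPartialBasis (hE : M.E = univ) (hk : 0 < k) {X : Finset α}
    {p : Finset α × Finset α} (h : IsPartialBasis M X p.1 p.2) :
    IsPartialBasis M X (basisUpdate M k p).1 (basisUpdate M k p).2 := by
  rcases p.2.eq_empty_or_nonempty with h0 | h0
  · have : p = (p.1, ∅) := by rw [← h0]
    rw [this, basisUpdate_empty, ← this]
    exact h
  · exact (basisUpdate_spec hE hk h h0).1

lemma basisUpdate_card_le (hE : M.E = univ) (hk : 0 < k) {X : Finset α}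
    {p : Finset α × Finset α} (h : IsPartialBasis M X p.1 p.2) :
    (basisUpdate M k p).2.card ≤ p.2.card := by
  rcases p.2.eq_empty_or_nonempty with h0 | h0
  · have : p = (p.1, ∅) := by rw [← h0]
    rw [this, basisUpdate_empty]
  · rcases (basisUpdate_spec hE hk h h0).2 with h | h <;>
      exact (Nat.le_add_right _ _).trans h.2

lemma iterate_isPartialBasis (hE : M.E = univ) (hk : 0 < k) {X : Finset α}
    {p : Finset α × Finset α} (h : IsPartialBasis M X p.1 p.2) (t : ℕ) :
    IsPartialBasis M X ((basisUpdate M k)^[t] p).1 ((basisUpdate M k)^[t] p).2 := by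
  induction t with
  | zero => exact h
  | succ t ih =>
    rw [Function.iterate_succ_apply']
    exact basisUpdate_isPartialBasis hE hk ih

/-- While many elements remain, a potential decreases. -/
lemma iterate_basisUpdate_large (hE : M.E = univ) (hk : 0 < k)
    (hM : ∀ I : Finset α, M.Indep (I : Set α) → I.card ≤ k) {X : Finset α} {N : ℕ}
    (hXN : X.card ≤ N) (t : ℕ)
    (ht : 3 * (Nat.sqrt k : ℝ) + 2 * Nat.sqrt k * Real.log (N / k) < t) :
    ((basisUpdate M k)^[t] (∅, X)).2.card ≤ 2 * k := by
  have h0 : IsPartialBasis M X ((∅ : Finset α), X).1 ((∅ : Finset α), X).2 :=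
    ⟨by simp, by simp, by simp⟩
  have hs0 : 0 < Nat.sqrt k := Nat.sqrt_pos.2 hk
  have hsk : Nat.sqrt k ≤ k := Nat.sqrt_le_self k
  have hs3 : (k : ℝ) ≤ 3 * Nat.sqrt k * Nat.sqrt k := by
    have h1 := Nat.sqrt_le_add k
    have : k ≤ 3 * Nat.sqrt k * Nat.sqrt k := by nlinarith
    exact_mod_cast this
  set s := Nat.sqrt k with hs
  have hsR : (0 : ℝ) < s := by exact_mod_cast hs0
  have hkR : (0 : ℝ) < k := by exact_mod_cast hk
  -- Adding a block lowers the first term by `1`. Dropping scales the number of remaining elements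
  -- by at most `1 - 1 / (2 * s)`, which lowers the logarithmic term by at least `1`.
  have key : ∀ t : ℕ, ((basisUpdate M k)^[t] (∅, X)).2.card ≤ 2 * k ∨
      ((k : ℝ) - ((basisUpdate M k)^[t] (∅, X)).1.card) / s +
        2 * s * Real.log (((basisUpdate M k)^[t] (∅, X)).2.card / k) + t ≤
        k / s + 2 * s * Real.log (N / k) := by
    intro t
    induction t with
    | zero =>
      by_cases hX : X.card ≤ 2 * k
      · exact Or.inl hX
      · right
        have h1 : (0 : ℝ) < X.card / k := by
          have : (0 : ℝ) < X.card := by exact_mod_cast (by omega : 0 < X.card)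
          positivity
        have h2 : Real.log (X.card / k) ≤ Real.log (N / k) :=
          Real.log_le_log h1 (by gcongr)
        simp only [Function.iterate_zero, id, Finset.card_empty, Nat.cast_zero, sub_zero, add_zero]
        gcongr
    | succ t ih =>
      rw [Function.iterate_succ_apply']
      have hinv := iterate_isPartialBasis hE hk h0 t
      generalize (basisUpdate M k)^[t] (∅, X) = p at ih hinv
      by_cases hnew : (basisUpdate M k p).2.card ≤ 2 * k
      · exact Or.inl hnew
      right
      have hmono := basisUpdate_card_le hE hk hinv
      have ih := ih.resolve_left (by omega)
      have hbs : blockSize k p.2.card = s := by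
        rw [blockSize, if_pos (by omega)]
      have hspec := (basisUpdate_spec hE hk hinv (Finset.card_pos.1 (by omega))).2
      rw [hbs] at hspec
      have hm' : (0 : ℝ) < (basisUpdate M k p).2.card := by
        exact_mod_cast (by omega : 0 < (basisUpdate M k p).2.card)
      have hm : (0 : ℝ) < p.2.card := by exact_mod_cast (by omega : 0 < p.2.card)
      rcases hspec with ⟨h1, h2⟩ | ⟨h1, h2⟩
      · have h3 : Real.log ((basisUpdate M k p).2.card / k) ≤ Real.log (p.2.card / k) :=
          Real.log_le_log (by positivity) (by gcongr)
        have h4 : ((k : ℝ) - (basisUpdate M k p).1.card) / s = (k - p.1.card) / s - 1 := by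
          rw [h1]; push_cast; field_simp; ring
        rw [h4]
        push_cast
        have := mul_le_mul_of_nonneg_left h3 (by positivity : (0 : ℝ) ≤ 2 * s)
        linarith
      · have hdiv : (p.2.card : ℝ) / (2 * s) ≤ ((p.2.card / s : ℕ) : ℝ) := by
          rw [div_le_iff₀ (by positivity)]
          have h5 : p.2.card < (p.2.card / s + 1) * s := Nat.lt_mul_of_div_lt (Nat.lt_succ_self _) hs0
          have h6 : 1 ≤ p.2.card / s := (Nat.le_div_iff_mul_le hs0).2 (by omega)
          have h7 : p.2.card ≤ p.2.card / s * (2 * s) := by nlinarith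
          exact_mod_cast h7
        have h2' : ((basisUpdate M k p).2.card : ℝ) + ((p.2.card / s : ℕ) : ℝ) ≤ p.2.card := by
          exact_mod_cast h2
        have h3 : Real.log ((basisUpdate M k p).2.card / k) ≤
            Real.log (p.2.card / k) - 1 / (2 * s) := by
          have h8 : ((basisUpdate M k p).2.card : ℝ) / k =
              (p.2.card / k) * ((basisUpdate M k p).2.card / p.2.card) := by field_simp
          rw [h8, Real.log_mul (by positivity) (by positivity)]
          have h9 := Real.log_le_sub_one_of_pos (div_pos hm' hm)
          have h10 : ((basisUpdate M k p).2.card : ℝ) / p.2.card ≤ 1 - 1 / (2 * s) := by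
            rw [div_le_iff₀ hm]
            have : (1 - 1 / (2 * (s : ℝ))) * p.2.card = p.2.card - p.2.card / (2 * s) := by
              field_simp
            rw [this]
            linarith
          linarith
        rw [h1]
        push_cast
        have h11 := mul_le_mul_of_nonneg_left h3 (by positivity : (0 : ℝ) ≤ 2 * s)
        have h12 : 2 * (s : ℝ) * (Real.log (p.2.card / k) - 1 / (2 * s)) =
            2 * s * Real.log (p.2.card / k) - 1 := by field_simp
        linarith
  rcases key t with h | h
  · exact h
  · by_contra hcon
    have h1 : (((basisUpdate M k)^[t] (∅, X)).1.card : ℝ) ≤ k := by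
      exact_mod_cast hM _ (iterate_isPartialBasis hE hk h0 t).indep
    have h2 : 0 ≤ ((k : ℝ) - ((basisUpdate M k)^[t] (∅, X)).1.card) / s :=
      div_nonneg (by linarith) hsR.le
    have h3 : 0 ≤ Real.log (((basisUpdate M k)^[t] (∅, X)).2.card / k) := by
      apply Real.log_nonneg
      rw [le_div_iff₀ hkR, one_mul]
      exact_mod_cast (by omega : k ≤ ((basisUpdate M k)^[t] (∅, X)).2.card)
    have h4 : (k : ℝ) / s ≤ 3 * s := by rw [div_le_iff₀ hsR]; exact hs3
    have := mul_nonneg (by positivity : (0 : ℝ) ≤ 2 * s) h3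
    linarith

/-- Once few elements remain, the square root of their number decreases. -/
lemma iterate_basisUpdate_small (hE : M.E = univ) (hk : 0 < k) {X : Finset α}
    {p : Finset α × Finset α} (h : IsPartialBasis M X p.1 p.2) (hp : p.2.card ≤ 2 * k) (t : ℕ)
    (ht : 4 * √(2 * k) < t) : ((basisUpdate M k)^[t] p).2 = ∅ := by
  -- Either outcome removes at least `Nat.sqrt m`, hence at least `√m / 2`, of the `m` remaining
  -- elements; this lowers `4 * √m` by at least `1`.
  have key : ∀ t : ℕ, ((basisUpdate M k)^[t] p).2.card ≤ 2 * k ∧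
      (((basisUpdate M k)^[t] p).2 = ∅ ∨
        4 * √(((basisUpdate M k)^[t] p).2.card) + t ≤ 4 * √(2 * k)) := by
    intro t
    induction t with
    | zero =>
      refine ⟨hp, Or.inr ?_⟩
      simp only [Function.iterate_zero, id, Nat.cast_zero, add_zero]
      gcongr
      exact_mod_cast hp
    | succ t ih =>
      rw [Function.iterate_succ_apply']
      have hinv := iterate_isPartialBasis hE hk h t
      generalize (basisUpdate M k)^[t] p = q at ih hinv
      obtain ⟨ih1, ih2⟩ := ih
      refine ⟨(basisUpdate_card_le hE hk hinv).trans ih1, ?_⟩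
      rcases q.2.eq_empty_or_nonempty with h0 | h0
      · left
        have : q = (q.1, ∅) := by rw [← h0]
        rw [this, basisUpdate_empty]
      right
      have ih2 := ih2.resolve_left h0.ne_empty
      have hbs : blockSize k q.2.card = Nat.sqrt q.2.card := by
        rw [blockSize, if_neg (by omega)]
      have hm0 : 0 < q.2.card := Finset.card_pos.2 h0
      have hs0 : 0 < Nat.sqrt q.2.card := Nat.sqrt_pos.2 hm0
      have hspec := (basisUpdate_spec hE hk hinv h0).2
      rw [hbs] at hspec
      have hdec : (basisUpdate M k q).2.card + Nat.sqrt q.2.card ≤ q.2.card := by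
        rcases hspec with h1 | h1
        · exact h1.2
        · have : Nat.sqrt q.2.card ≤ q.2.card / Nat.sqrt q.2.card :=
            (Nat.le_div_iff_mul_le hs0).2 (Nat.sqrt_le _)
          omega
      have hsq : √(q.2.card : ℝ) ≤ 2 * Nat.sqrt q.2.card := by
        have h1 : q.2.card ≤ (2 * Nat.sqrt q.2.card) ^ 2 := by
          have := Nat.sqrt_le_add q.2.card
          nlinarith
        rw [Real.sqrt_le_left (by positivity)]
        exact_mod_cast h1
      have hdec' : ((basisUpdate M k q).2.card : ℝ) + Nat.sqrt q.2.card ≤ q.2.card := by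
        exact_mod_cast hdec
      have hpos : 0 < √(q.2.card : ℝ) := Real.sqrt_pos.2 (by exact_mod_cast hm0)
      have h2 := Real.sq_sqrt (Nat.cast_nonneg (α := ℝ) q.2.card)
      have h1q : 1 ≤ √(q.2.card : ℝ) := by
        rw [Real.one_le_sqrt]; exact_mod_cast hm0
      have hroot : √((basisUpdate M k q).2.card : ℝ) ≤ √(q.2.card : ℝ) - 1 / 4 := by
        rw [Real.sqrt_le_left (by linarith)]
        nlinarith
      push_cast
      linarith
  rcases (key t).2 with h | h
  · exact h
  · have := Real.sqrt_nonneg (((basisUpdate M k)^[t] p).2.card : ℝ)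
    linarith

/-- The number of rounds of the parallel search for a basis among `N` elements in rank `k`. -/
noncomputable def basisRounds (N k : ℕ) : ℕ :=
  (⌊4 * √(2 * k)⌋₊ + 1) +
    (⌊3 * (Nat.sqrt k : ℝ) + 2 * Nat.sqrt k * Real.log (N / k)⌋₊ + 1)

lemma iterate_basisUpdate_card (hE : M.E = univ) (hk : 0 < k)
    (hM : ∀ I : Finset α, M.Indep (I : Set α) → I.card ≤ k) {X : Finset α} {N : ℕ}
    (hXN : X.card ≤ N) :
    ((basisUpdate M k)^[basisRounds N k] (∅, X)).1.card = (M.eRk (X : Set α)).toNat := by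
  have h0 : IsPartialBasis M X ((∅ : Finset α), X).1 ((∅ : Finset α), X).2 :=
    ⟨by simp, by simp, by simp⟩
  have h1 := iterate_isPartialBasis hE hk h0 (basisRounds N k)
  have h2 : ((basisUpdate M k)^[basisRounds N k] (∅, X)).2 = ∅ := by
    -- The right summand is run first: it reduces to `2 * k` elements, from which the left one
    -- finishes.
    rw [basisRounds, Function.iterate_add_apply]
    refine iterate_basisUpdate_small hE hk (iterate_isPartialBasis hE hk h0 _) ?_ _
      (by exact_mod_cast Nat.lt_floor_add_one _)
    exact iterate_basisUpdate_large hE hk hM hXN _ (by exact_mod_cast Nat.lt_floor_add_one _)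
  have h3 := h1.closure
  rw [h2, Finset.union_empty] at h3
  rw [← M.eRk_closure_eq, ← h3, M.eRk_closure_eq, h1.indep.eRk_eq_encard,
    Set.encard_coe_eq_coe_finsetCard]
  rfl

end BasisSearch

/-! ### Simultaneous searches by independence queries -/

section Search

variable {Q A α ι : Type} [Fintype α] [DecidableEq α] [Fintype ι] {M₁ M₂ : Matroid α}
  {f : Finset α ⊕ Finset α → Q} {g : Finset α ⊕ Finset α → A → Prop} {o : Q → A}

/-- Test the independence of a family of sets in one round. -/
noncomputable def askIndep (f : Finset α ⊕ Finset α → Q) (g : Finset α ⊕ Finset α → A → Prop)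
    (q : ι → Finset α ⊕ Finset α) : ParallelAlg Q A (ι → Prop) :=
  (ParallelAlg.ask fun i => f (q i)).bind fun a => .done fun i => g (q i) (a i)

lemma askIndep_output (hfg : ∀ q, g q (o (f q)) ↔ sideIndep M₁ M₂ q)
    (q : ι → Finset α ⊕ Finset α) :
    (askIndep f g q).output o = fun i => sideIndep M₁ M₂ (q i) := by
  simp [askIndep, hfg]

lemma askIndep_rounds (q : ι → Finset α ⊕ Finset α) : (askIndep f g q).rounds o = 1 := by
  simp [askIndep]

lemma askIndep_width (q : ι → Finset α ⊕ Finset α) :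
    (askIndep f g q).width o = Fintype.card ι := by
  simp [askIndep]

/-- The same query for the set `Y`. -/
def retarget (q : Finset α ⊕ Finset α) (Y : Finset α) : Finset α ⊕ Finset α :=
  q.map (fun _ => Y) fun _ => Y

/-- The matroid that is named by the query. -/
def sideMatroid (M₁ M₂ : Matroid α) (q : Finset α ⊕ Finset α) : Matroid α :=
  q.elim (fun _ => M₁) fun _ => M₂

/-- The set that is queried. -/
def target (q : Finset α ⊕ Finset α) : Finset α := q.elim id id

lemma sideIndep_retarget (q : Finset α ⊕ Finset α) (Y : Finset α) :
    sideIndep M₁ M₂ (retarget q Y) ↔ (sideMatroid M₁ M₂ q).Indep (Y : Set α) := by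
  cases q <;> rfl

/-- One round of the simultaneous search for bases of a family of sets. -/
noncomputable def searchRound (f : Finset α ⊕ Finset α → Q) (g : Finset α ⊕ Finset α → A → Prop)
    (k : ℕ) (q : ι → Finset α ⊕ Finset α) (st : ι → Finset α × Finset α) :
    ParallelAlg Q A (ι → Finset α × Finset α) :=
  (askIndep f g fun x : ι × α => retarget (q x.1)
      ((st x.1).1 ∪ blockUpTo (blockSize k (st x.1).2.card) (st x.1).2 x.2)).bind fun a =>
    .done fun i => basisStep (blockSize k (st i).2.card) (fun x => a (i, x)) (st i).1 (st i).2

lemma searchRound_output (hfg : ∀ q, g q (o (f q)) ↔ sideIndep M₁ M₂ q) (k : ℕ)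
    (q : ι → Finset α ⊕ Finset α) (st : ι → Finset α × Finset α) :
    (searchRound f g k q st).output o = fun i => basisUpdate (sideMatroid M₁ M₂ (q i)) k (st i) := by
  simp only [searchRound, ParallelAlg.output_bind, ParallelAlg.output_done, askIndep_output hfg,
    basisUpdate, sideIndep_retarget]

/-- The ranks of a family of sets, found by independence queries. -/
noncomputable def searchRanks (f : Finset α ⊕ Finset α → Q) (g : Finset α ⊕ Finset α → A → Prop)
    (k : ℕ) (q : ι → Finset α ⊕ Finset α) : ParallelAlg Q A (ι → ℕ) :=
  (ParallelAlg.iter (searchRound f g k q) (basisRounds (Fintype.card α) k)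
    fun i => (∅, target (q i))).bind fun st => .done fun i => (st i).1.card

lemma searchRanks_output (hfg : ∀ q, g q (o (f q)) ↔ sideIndep M₁ M₂ q) {k : ℕ} (hk : 0 < k)
    (hE₁ : M₁.E = univ) (hE₂ : M₂.E = univ)
    (hM₁ : ∀ I : Finset α, M₁.Indep (I : Set α) → I.card ≤ k)
    (hM₂ : ∀ I : Finset α, M₂.Indep (I : Set α) → I.card ≤ k) (q : ι → Finset α ⊕ Finset α) :
    (searchRanks f g k q).output o = fun i => sideRank M₁ M₂ (q i) := by
  -- The searches share their rounds, but each coordinate evolves as a search of its own.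
  have hiter : ∀ (t : ℕ) (st : ι → Finset α × Finset α) (i : ι),
      ((fun st => (searchRound f g k q st).output o)^[t] st) i =
        (basisUpdate (sideMatroid M₁ M₂ (q i)) k)^[t] (st i) := by
    intro t
    induction t with
    | zero => simp
    | succ t ih =>
      intro st i
      rw [Function.iterate_succ_apply', Function.iterate_succ_apply', searchRound_output hfg, ← ih]
  funext i
  simp only [searchRanks, ParallelAlg.output_bind, ParallelAlg.output_done,
    ParallelAlg.output_iter, hiter]
  rcases q i with X | X
  · exact iterate_basisUpdate_card hE₁ hk hM₁ (Finset.card_le_univ X)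
  · exact iterate_basisUpdate_card hE₂ hk hM₂ (Finset.card_le_univ X)

lemma searchRanks_rounds (k : ℕ) (q : ι → Finset α ⊕ Finset α) :
    (searchRanks f g k q).rounds o ≤ basisRounds (Fintype.card α) k := by
  simpa [searchRanks] using ParallelAlg.rounds_iter_le o (f := searchRound f g k q) (c := 1)
    (fun st => by simp [searchRound, askIndep_rounds]) (basisRounds (Fintype.card α) k) _

lemma searchRanks_width (k : ℕ) (q : ι → Finset α ⊕ Finset α) :
    (searchRanks f g k q).width o ≤ Fintype.card ι * Fintype.card α := by
  simpa [searchRanks] using ParallelAlg.width_iter_le o (f := searchRound f g k q)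
    (c := Fintype.card ι * Fintype.card α)
    (fun st => by simp [searchRound, askIndep_width]) (basisRounds (Fintype.card α) k) _

end Search

/-! ### Simulating the padded matroids -/

section PaddedAccess

variable {n k : ℕ} {M₁ M₂ : Matroid (Fin n)}

/-- The query to the given matroids that answers a query to the padded matroids. -/
def unpadQuery (q : Finset (Fin n ⊕ Fin k) ⊕ Finset (Fin n ⊕ Fin k)) : Query n :=
  q.map Finset.toLeft Finset.toLeft

/-- Access to the padded matroids through independence oracles. -/
noncomputable def indepAccess (n k : ℕ) : Access (Query n) Bool (Fin n ⊕ Fin k) :=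
  accessOf (searchRanks unpadQuery (fun q b => b = true ∧ (target q).card ≤ k) k)
    (askIndep unpadQuery fun q b => b = true ∧ (target q).card ≤ k)

/-- Access to the padded matroids through rank oracles. -/
noncomputable def rankAccess (n k : ℕ) : Access (Query n) ℕ (Fin n ⊕ Fin k) :=
  accessOf
    (fun q => (ParallelAlg.ask fun i => unpadQuery (q i)).bind fun a =>
      .done fun i => min k (a i + (target (q i)).toRight.card))
    (askIndep unpadQuery fun q a => a = (target q).toLeft.card ∧ (target q).card ≤ k)

lemma card_pad_le {M : Matroid (Fin n)} (I : Finset (Fin n ⊕ Fin k))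
    (h : (pad M k).Indep (I : Set (Fin n ⊕ Fin k))) : I.card ≤ k :=
  (pad_indep.1 h).2

/-- The greedy bases need the ranks of `4 * (n + k)` sets, and each search makes `n + k` tests per
round. The truncation is checked by counting, without a query. -/
lemma indepAccess_correct (hk : 0 < k) : (indepAccess n k).Correct (indepOracle M₁ M₂)
    (pad M₁ k) (pad M₂ k) (basisRounds (n + k) k) (4 * (n + k) ^ 2) := by
  have hfg : ∀ q : Finset (Fin n ⊕ Fin k) ⊕ Finset (Fin n ⊕ Fin k),
      (indepOracle M₁ M₂ (unpadQuery q) = true ∧ (target q).card ≤ k) ↔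
        sideIndep (pad M₁ k) (pad M₂ k) q := by
    rintro (X | X) <;> simp [unpadQuery, indepOracle, target, sideIndep, pad_indep]
  refine accessOf_correct pad_ground pad_ground
    (searchRanks_output hfg hk pad_ground pad_ground card_pad_le card_pad_le)
    (fun q => by simpa using searchRanks_rounds k q) (fun q => ?_) (askIndep_output hfg)
    (fun q => (askIndep_rounds q).le) (fun q => ?_)
  · refine (searchRanks_width k q).trans (le_of_eq ?_)
    simp
    ring
  · rw [askIndep_width]
    simp
    nlinarith

lemma rankAccess_correct (hE₁ : M₁.E = univ) (hE₂ : M₂.E = univ) :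
    (rankAccess n k).Correct (rankOracle M₁ M₂) (pad M₁ k) (pad M₂ k) 1 (4 * (n + k) ^ 2) := by
  have hfg : ∀ q : Finset (Fin n ⊕ Fin k) ⊕ Finset (Fin n ⊕ Fin k),
      (rankOracle M₁ M₂ (unpadQuery q) = (target q).toLeft.card ∧ (target q).card ≤ k) ↔
        sideIndep (pad M₁ k) (pad M₂ k) q := by
    rintro (X | X)
    · simp only [unpadQuery, Sum.map_inl, rankOracle, target, sideIndep, Sum.elim_inl, id, pad_indep]
      rw [indep_iff_natRank]
      rfl
    · simp only [unpadQuery, Sum.map_inr, rankOracle, target, sideIndep, Sum.elim_inr, id, pad_indep]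
      rw [indep_iff_natRank]
      rfl
  have hsq : n + k ≤ (n + k) ^ 2 := Nat.le_self_pow two_ne_zero _
  refine accessOf_correct pad_ground pad_ground (fun q => ?_) (fun q => by simp) (fun q => ?_)
    (askIndep_output hfg) (fun q => (askIndep_rounds q).le) (fun q => ?_)
  · funext i
    simp only [ParallelAlg.output_bind, ParallelAlg.output_ask, ParallelAlg.output_done]
    rcases q i with X | X
    · exact (natRank_pad hE₁ X).symm
    · exact (natRank_pad hE₂ X).symm
  · simp
    nlinarith
  · rw [askIndep_width]
    simp
    nlinarith

end PaddedAccess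

/-! ### Optimal common independent sets of bounded size -/

section BoundedSize

variable {n k : ℕ} {M₁ M₂ : Matroid (Fin n)} {Q A : Type} {o : Q → A}
  {acc : Access Q A (Fin n ⊕ Fin k)} {t c : ℕ}

/-- The number of scaling phases. -/
def phaseLog {n : ℕ} (k : ℕ) (w : Fin n → ℤ) : ℕ := Nat.log 2 ((k + 1) * maxAbsWeight w)

/-- A common independent set of maximum weight among those with at most `k` elements. -/
noncomputable def solveBounded (acc : Access Q A (Fin n ⊕ Fin k)) (d X Y : ℕ) (w : Fin n → ℤ) :
    ParallelAlg Q A (Finset (Fin n)) :=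
  (maxWeightBase acc k d X Y (phaseLog k w) (Sum.elim w fun _ => 0) (padBase n k)).bind
    fun S => .done S.toLeft

lemma solveBounded_rounds (h : acc.Correct o (pad M₁ k) (pad M₂ k) t c) (d X Y : ℕ)
    (w : Fin n → ℤ) :
    (solveBounded acc d X Y w).rounds o ≤ (phaseLog k w + 1) * (X * t + (t + Y)) := by
  simpa [solveBounded] using maxWeightBase_rounds h X Y (phaseLog k w) (padBase n k)

lemma solveBounded_width (h : acc.Correct o (pad M₁ k) (pad M₂ k) t c) (d X Y : ℕ)
    (w : Fin n → ℤ) : (solveBounded acc d X Y w).width o ≤ c := by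
  simpa [solveBounded] using maxWeightBase_width h X Y (phaseLog k w) (padBase n k)

lemma solveBounded_output (h : acc.Correct o (pad M₁ k) (pad M₂ k) t c) {d X Y : ℕ}
    (hXY : PhaseParams (n + k) k d X Y) (w : Fin n → ℤ) {S : Finset (Fin n)}
    (hS : S = (solveBounded acc d X Y w).output o) :
    CommonIndep M₁ M₂ S ∧ S.card ≤ k ∧
      ∀ T, CommonIndep M₁ M₂ T → T.card ≤ k → ∑ e ∈ T, w e ≤ ∑ e ∈ S, w e := by
  simp only [solveBounded, ParallelAlg.output_bind, ParallelAlg.output_done] at hS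
  have hD : ∀ M : Matroid (Fin n), (pad M k).IsBase (padBase n k : Set (Fin n ⊕ Fin k)) := fun M =>
    pad_isBase_iff.2 ⟨by simp [toLeft_padBase], card_padBase⟩
  have hsum : ∀ B : Finset (Fin n ⊕ Fin k),
      ∑ e ∈ B, (Sum.elim w fun _ => 0) e = ∑ e ∈ B.toLeft, w e := fun B => by
    conv_lhs => rw [← Finset.toLeft_disjSum_toRight (u := B)]
    rw [Finset.sum_disjSum]
    simp
  obtain ⟨h1, h2, h3⟩ := maxWeightBase_output (w := Sum.elim w fun _ => 0) (L := phaseLog k w) h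
    pad_ground pad_ground (fun B hB => (pad_isBase_iff.1 hB).2) (fun B hB => (pad_isBase_iff.1 hB).2)
    (by simpa using hXY) (hD M₁) (hD M₂) (by
      rintro (e | e)
      · have h1 : (w e).natAbs ≤ maxAbsWeight w :=
          Finset.le_sup (f := fun e => (w e).natAbs) (Finset.mem_univ e)
        -- The first precision `2 ^ phaseLog k w` is large enough that all scaled weights are within
        -- twice it of `0`.
        have h2 := Nat.lt_pow_succ_log_self one_lt_two ((k + 1) * maxAbsWeight w)
        have h3 : (k + 1) * (w e).natAbs ≤ 2 * 2 ^ phaseLog k w := by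
          rw [← pow_succ']
          exact (Nat.mul_le_mul_left _ h1).trans h2.le
        rw [Sum.elim_inl, Int.abs_eq_natAbs]
        exact_mod_cast h3
      · simp) rfl
  generalize (maxWeightBase acc k d X Y (phaseLog k w) (Sum.elim w fun _ => 0)
    (padBase n k)).output o = B at hS h1 h2 h3
  subst hS
  rw [pad_isBase_iff] at h1 h2
  refine ⟨⟨h1.1, h2.1⟩, ?_, fun T hT hTk => ?_⟩
  · have := Finset.card_toLeft_add_card_toRight (u := B)
    omega
  · obtain ⟨C, rfl, hC₁, hC₂⟩ := exists_pad_isBase hT hTk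
    have := h3 C hC₁ hC₂
    rwa [hsum, hsum] at this

end BoundedSize

/-! ### Balancing auction and augmentations -/

section Parameters

/-- The depth of the auction when greedy bases are found in `t` rounds. -/
def phaseDepth (n k t : ℕ) : ℕ := Nat.findGreatest (fun d => d ^ 3 * (n + k) * t ≤ k ^ 2) k

/-- The number of rounds of auction in a phase. -/
def auctionLength (n k t : ℕ) : ℕ :=
  if phaseDepth n k t = 0 then 0 else 2 * phaseDepth n k t ^ 2 * (n + k) / k + 1

/-- The number of augmentations in a phase. -/
def augmentLength (n k t : ℕ) : ℕ :=
  if phaseDepth n k t = 0 then k else 6 * k / phaseDepth n k t + 1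

lemma phaseParams (n t : ℕ) {k : ℕ} (hk : 0 < k) :
    PhaseParams (n + k) k (phaseDepth n k t) (auctionLength n k t) (augmentLength n k t) := by
  unfold PhaseParams auctionLength augmentLength
  by_cases hd : phaseDepth n k t = 0
  · simp [hd]
  · right
    simp only [hd, if_false]
    have hd' : 0 < phaseDepth n k t := Nat.pos_of_ne_zero hd
    exact ⟨Nat.lt_mul_of_div_lt (Nat.lt_succ_self _) hk, hd',
      (Nat.lt_mul_of_div_lt (Nat.lt_succ_self _) hd').le⟩

/-- For `d ^ 3 * (n + k) * t` near `k ^ 2`, auction and augmentations both cost about the cube root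
of `(n + k) * k * t`, which `b` dominates. The auction gives `2 * b`, the augmentations `12 * b +
1`, and `K * b` bounds `t`, which is paid twice: for rounding up the auction length and for the
final greedy bases. -/
lemma phaseLength_le {n k t : ℕ} (hk : 0 < k) (ht : 0 < t) {K b : ℝ} (hK : 0 ≤ K) (hb : 0 ≤ b)
    (htK : (t : ℝ) ^ 2 ≤ K ^ 3 * (n + k) * k) (hbt : ((n : ℝ) + k) * k * t ≤ b ^ 3) :
    ((auctionLength n k t * t + (t + augmentLength n k t) : ℕ) : ℝ) ≤ (15 + 2 * K) * b := by
  have hkR : (0 : ℝ) < k := by exact_mod_cast hk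
  have hk1 : (1 : ℝ) ≤ k := by exact_mod_cast hk
  have htR : (0 : ℝ) < t := by exact_mod_cast ht
  have ht1 : (1 : ℝ) ≤ t := by exact_mod_cast ht
  have hn : (0 : ℝ) ≤ n := Nat.cast_nonneg n
  have hN1 : (1 : ℝ) ≤ (n : ℝ) + k := by linarith
  have htb : (t : ℝ) ≤ K * b := by
    refine le_of_pow_le_pow_left₀ three_ne_zero (by positivity) ?_
    calc (t : ℝ) ^ 3 = t ^ 2 * t := by ring
      _ ≤ K ^ 3 * ((n : ℝ) + k) * k * t := by gcongr
      _ = K ^ 3 * ((n + k) * k * t) := by ring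
      _ ≤ K ^ 3 * b ^ 3 := by gcongr
      _ = (K * b) ^ 3 := by ring
  have hb1 : 1 ≤ b := by
    refine le_of_pow_le_pow_left₀ three_ne_zero hb ?_
    refine le_trans ?_ hbt
    rw [one_pow]
    exact one_le_mul_of_one_le_of_one_le (one_le_mul_of_one_le_of_one_le hN1 hk1) ht1
  by_cases hd : phaseDepth n k t = 0
  -- Even depth `1` is too expensive here, so `k ^ 2 ≤ (n + k) * t`, and `k` augmentations without
  -- any auction stay within `b`.
  · simp only [auctionLength, augmentLength, hd, if_true]
    have h1 : ¬ (1 ^ 3 * (n + k) * t ≤ k ^ 2) :=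
      Nat.findGreatest_is_greatest (P := fun d => d ^ 3 * (n + k) * t ≤ k ^ 2) (n := k)
        (by change phaseDepth n k t < 1; omega) hk
    have h2 : (k : ℝ) ^ 2 ≤ (n + k) * t := by
      have : k ^ 2 ≤ (n + k) * t := by linarith [not_le.1 h1]
      exact_mod_cast this
    have h3 : (k : ℝ) ≤ b := by
      refine le_of_pow_le_pow_left₀ three_ne_zero hb (le_trans ?_ hbt)
      calc (k : ℝ) ^ 3 = k ^ 2 * k := by ring
        _ ≤ ((n : ℝ) + k) * t * k := by gcongr
        _ = _ := by ring
    push_cast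
    nlinarith
  · simp only [auctionLength, augmentLength, hd, if_false]
    have hspec : phaseDepth n k t ^ 3 * (n + k) * t ≤ k ^ 2 :=
      Nat.findGreatest_spec (P := fun d => d ^ 3 * (n + k) * t ≤ k ^ 2) (Nat.zero_le k) (by simp)
    -- Maximality of the depth gives this, unless the search bound `k` stopped it; then `k ≤ d + 1`
    -- suffices.
    have hmax : k ^ 2 ≤ (phaseDepth n k t + 1) ^ 3 * (n + k) * t := by
      by_cases hlt : phaseDepth n k t + 1 ≤ k
      · exact (not_le.1 (Nat.findGreatest_is_greatest
          (P := fun d => d ^ 3 * (n + k) * t ≤ k ^ 2) (n := k)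
          (by change phaseDepth n k t < _; omega) hlt)).le
      · have h1 : k ≤ phaseDepth n k t + 1 := by omega
        calc k ^ 2 ≤ (phaseDepth n k t + 1) ^ 2 := Nat.pow_le_pow_left h1 2
          _ ≤ (phaseDepth n k t + 1) ^ 3 := Nat.pow_le_pow_right (by omega) (by omega)
          _ = (phaseDepth n k t + 1) ^ 3 * 1 * 1 := by ring
          _ ≤ _ := Nat.mul_le_mul (Nat.mul_le_mul_left _ (by omega)) ht
    generalize phaseDepth n k t = d at hd hspec hmax
    have hd1 : 1 ≤ d := Nat.one_le_iff_ne_zero.2 hd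
    have hdR : (1 : ℝ) ≤ d := by exact_mod_cast hd1
    have hspecR : (d : ℝ) ^ 3 * (n + k) * t ≤ k ^ 2 := by exact_mod_cast hspec
    have hmaxR : (k : ℝ) ^ 2 ≤ 8 * (d ^ 3 * (n + k) * t) := by
      have h1 : (k : ℝ) ^ 2 ≤ (d + 1) ^ 3 * (n + k) * t := by exact_mod_cast hmax
      have h2 : ((d : ℝ) + 1) ^ 3 ≤ (2 * d) ^ 3 := by gcongr; linarith
      calc (k : ℝ) ^ 2 ≤ (d + 1) ^ 3 * (n + k) * t := h1
        _ ≤ (2 * (d : ℝ)) ^ 3 * (n + k) * t := by gcongr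
        _ = _ := by ring
    have h1 : (d : ℝ) ^ 2 * (n + k) / k * t ≤ b := by
      refine le_of_pow_le_pow_left₀ three_ne_zero hb (le_trans ?_ hbt)
      calc ((d : ℝ) ^ 2 * (n + k) / k * t) ^ 3
          = ((d : ℝ) ^ 3 * (n + k) * t) ^ 2 * (((n : ℝ) + k) * t / k ^ 3) := by field_simp
        _ ≤ ((k : ℝ) ^ 2) ^ 2 * (((n : ℝ) + k) * t / k ^ 3) := by gcongr
        _ = ((n : ℝ) + k) * k * t := by field_simp
    have h2 : (k : ℝ) / d ≤ 2 * b := by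
      refine le_of_pow_le_pow_left₀ three_ne_zero (by positivity) ?_
      have h3 : (k : ℝ) ^ 3 ≤ 8 * b ^ 3 * d ^ 3 := by
        calc (k : ℝ) ^ 3 = k ^ 2 * k := by ring
          _ ≤ 8 * ((d : ℝ) ^ 3 * (n + k) * t) * k := by gcongr
          _ = 8 * (((n : ℝ) + k) * k * t) * d ^ 3 := by ring
          _ ≤ 8 * b ^ 3 * (d : ℝ) ^ 3 := by gcongr
      rw [div_pow, div_le_iff₀ (by positivity)]
      calc (k : ℝ) ^ 3 ≤ 8 * b ^ 3 * d ^ 3 := h3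
        _ = _ := by ring
    have h3 : ((2 * d ^ 2 * (n + k) / k : ℕ) : ℝ) ≤ 2 * (d ^ 2 * (n + k) / k) := by
      refine Nat.cast_div_le.trans (le_of_eq ?_)
      push_cast
      ring
    have h4 : ((6 * k / d : ℕ) : ℝ) ≤ 6 * (k / d) := by
      refine Nat.cast_div_le.trans (le_of_eq ?_)
      push_cast
      ring
    push_cast
    have h5 := mul_le_mul_of_nonneg_right h3 htR.le
    nlinarith

/-- `k + 1 ≤ 4 * r`, and `Real.log 2 ≥ 1 / 2` turns the binary logarithm of `4 * (W * r)` into at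
most `2 + 2 * Real.log (W * r)`. -/
lemma phaseLog_le {n k r W : ℕ} {w : Fin n → ℤ} (hw : maxAbsWeight w ≤ W) (hW : 0 < W)
    (hr : 0 < r) (hk : k ≤ 2 * r) :
    ((phaseLog k w + 1 : ℕ) : ℝ) ≤ 5 * max 1 (Real.log (W * r)) := by
  have hlog2 : (1 / 2 : ℝ) ≤ Real.log 2 := by linarith [Real.log_two_gt_d9]
  have hmono : phaseLog k w ≤ Nat.log 2 (4 * (W * r)) :=
    Nat.log_mono_right (by
      calc (k + 1) * maxAbsWeight w ≤ (4 * r) * W := Nat.mul_le_mul (by omega) hw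
        _ = _ := by ring)
  have hWr : 0 < W * r := Nat.mul_pos hW hr
  have hWrR : (1 : ℝ) ≤ W * r := by exact_mod_cast hWr
  have hpow : ((2 : ℝ) ^ Nat.log 2 (4 * (W * r))) ≤ 4 * (W * r) := by
    exact_mod_cast Nat.pow_log_le_self 2 (by omega : 4 * (W * r) ≠ 0)
  have hlog := Real.log_le_log (by positivity) hpow
  rw [Real.log_pow, Real.log_mul (by norm_num) (by positivity),
    show (4 : ℝ) = 2 ^ 2 by norm_num, Real.log_pow] at hlog
  have hx : 0 ≤ Real.log (W * r) := Real.log_nonneg hWrR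
  set x := Real.log (W * r)
  have h1 : (Nat.log 2 (4 * (W * r)) : ℝ) ≤ 2 + 2 * x := by
    by_contra hcon
    push Not at hcon
    push_cast at hlog
    nlinarith
  have h2 : (phaseLog k w : ℝ) ≤ Nat.log 2 (4 * (W * r)) := by exact_mod_cast hmono
  push_cast
  have := le_max_left 1 x
  have := le_max_right 1 x
  linarith

end Parameters

/-! ### Guessing the common rank by doubling -/

section Doubling

variable {n : ℕ} {M₁ M₂ : Matroid (Fin n)}

lemma commonIndep_empty : CommonIndep M₁ M₂ ∅ := by simp [CommonIndep]

lemma CommonIndep.subset {S T : Finset (Fin n)} (hT : CommonIndep M₁ M₂ T) (h : S ⊆ T) :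
    CommonIndep M₁ M₂ S :=
  ⟨hT.1.subset (by exact_mod_cast h), hT.2.subset (by exact_mod_cast h)⟩

lemma CommonIndep.card_le {S : Finset (Fin n)} (hS : CommonIndep M₁ M₂ S) :
    S.card ≤ commonRank M₁ M₂ := by
  classical
  exact Finset.le_sup (f := Finset.card) (Finset.mem_filter.2 ⟨Finset.mem_univ S, hS⟩)

lemma exists_card_eq_commonRank (M₁ M₂ : Matroid (Fin n)) :
    ∃ T, CommonIndep M₁ M₂ T ∧ T.card = commonRank M₁ M₂ := by
  classical
  obtain ⟨T, hT, h⟩ := Finset.exists_mem_eq_sup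
    (Finset.univ.filter fun S : Finset (Fin n) => CommonIndep M₁ M₂ S)
    ⟨∅, Finset.mem_filter.2 ⟨Finset.mem_univ _, commonIndep_empty⟩⟩ Finset.card
  refine ⟨T, (Finset.mem_filter.1 hT).2, ?_⟩
  rw [← h, commonRank]

lemma commonRank_le : commonRank M₁ M₂ ≤ n := by
  obtain ⟨T, -, hT⟩ := exists_card_eq_commonRank M₁ M₂
  rw [← hT]
  simpa using Finset.card_le_univ T

variable {Q A : Type} {o : Q → A}

/-- Double `k` until the largest common independent set with at most `k` elements, which is provided
by `solver k`, has less than `k` elements. -/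
def doubling (solver : ℕ → ParallelAlg Q A (Finset (Fin n))) : ℕ → ℕ → ParallelAlg Q A ℕ
  | 0, k => .done k
  | f + 1, k => (solver k).bind fun S => if S.card < k then .done k else doubling solver f (2 * k)

/-- Growth by `6 / 5` gives `β k ≤ 5 * (β (2 * k) - β k)`, so the costs of the successive runs
telescope. The hypothesis `hf` ensures that exhausted fuel also means a bound above `r₀`. -/
lemma doubling_spec {solver : ℕ → ParallelAlg Q A (Finset (Fin n))} {r₀ c : ℕ} {β : ℕ → ℝ}
    (hout : ∀ k, 0 < k → k ≤ 2 * max 1 r₀ → ((solver k).output o).card = min k r₀)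
    (hrounds : ∀ k, 0 < k → k ≤ 2 * max 1 r₀ → ((solver k).rounds o : ℝ) ≤ β k)
    (hwidth : ∀ k, 0 < k → k ≤ 2 * max 1 r₀ → (solver k).width o ≤ c)
    (hβ : ∀ k, 0 < k → k ≤ 2 * max 1 r₀ → 0 ≤ β k ∧ 6 / 5 * β k ≤ β (2 * k)) (f k : ℕ) (hk : 0 < k)
    (hkr : k ≤ 2 * max 1 r₀) (hf : r₀ < 2 ^ f * k) :
    r₀ < (doubling solver f k).output o ∧ (doubling solver f k).output o ≤ 2 * max 1 r₀ ∧
      ((doubling solver f k).rounds o : ℝ) ≤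
        5 * (β (2 * (doubling solver f k).output o) - β k) ∧
      (doubling solver f k).width o ≤ c := by
  induction f generalizing k with
  | zero =>
    simp only [doubling, ParallelAlg.output_done, ParallelAlg.rounds_done, ParallelAlg.width_done]
    obtain ⟨h1, h2⟩ := hβ k hk hkr
    refine ⟨by simpa using hf, hkr, ?_, Nat.zero_le _⟩
    push_cast
    linarith
  | succ f ih =>
    simp only [doubling, ParallelAlg.output_bind, ParallelAlg.rounds_bind, ParallelAlg.width_bind,
      hout k hk hkr]
    obtain ⟨h1, h2⟩ := hβ k hk hkr
    have h3 := hrounds k hk hkr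
    split_ifs with hlt
    · simp only [ParallelAlg.output_done, ParallelAlg.rounds_done, ParallelAlg.width_done]
      refine ⟨by omega, hkr, ?_, max_le (hwidth k hk hkr) (Nat.zero_le _)⟩
      push_cast
      linarith
    · obtain ⟨h4, h5, h6, h7⟩ := ih (2 * k) (by omega) (by omega)
        (by rw [pow_succ] at hf; linarith)
      refine ⟨h4, h5, ?_, max_le (hwidth k hk hkr) h7⟩
      push_cast
      linarith

end Doubling

/-! ### The complete algorithm for either oracle -/

section Main

variable {A : Type}

/-- The algorithm for common independent sets with at most `k` elements, with all parameters. -/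
noncomputable def solver (acc : ∀ n k, Access (Query n) A (Fin n ⊕ Fin k)) (t : ℕ → ℕ → ℕ) (n : ℕ)
    (w : Fin n → ℤ) (k : ℕ) : ParallelAlg (Query n) A (Finset (Fin n)) :=
  solveBounded (acc n k) (phaseDepth n k (t n k)) (auctionLength n k (t n k))
    (augmentLength n k (t n k)) w

/-- The complete algorithm: find an upper bound for the common rank by doubling, then solve. -/
noncomputable def fullAlg (acc : ∀ n k, Access (Query n) A (Fin n ⊕ Fin k)) (t : ℕ → ℕ → ℕ) (n : ℕ)
    (w : Fin n → ℤ) : ParallelAlg (Query n) A (Finset (Fin n)) :=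
  if maxAbsWeight w = 0 then .done ∅
  else (doubling (solver acc t n fun _ => 1) n 1).bind (solver acc t n w)

/-- The empty set is optimal for zero weights. Otherwise unit weights are no larger than the given
ones, so the doubling runs obey the same logarithmic bound. The factor `30` is `5 * 5` for doubling
plus `5` for the final run. -/
lemma fullAlg_spec {acc : ∀ n k, Access (Query n) A (Fin n ⊕ Fin k)} {t : ℕ → ℕ → ℕ} {n : ℕ}
    {M₁ M₂ : Matroid (Fin n)} {o : Query n → A} {h : ℕ → ℝ} {K B : ℝ}
    (hacc : ∀ k, 0 < k → (acc n k).Correct o (pad M₁ k) (pad M₂ k) (t n k) (4 * (n + k) ^ 2))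
    (hK : 0 ≤ K) (ht : ∀ k, 0 < k → k ≤ 2 * n → 0 < t n k ∧ (t n k : ℝ) ^ 2 ≤ K ^ 3 * (n + k) * k)
    (hh : ∀ k, 0 < k → k ≤ 2 * n → 0 ≤ h k ∧ ((n : ℝ) + k) * k * t n k ≤ h k ^ 3 ∧
      6 / 5 * h k ≤ h (2 * k)) {r : ℕ} (hr : r = max 1 (commonRank M₁ M₂))
    (hB : 0 ≤ B) (hB' : ∀ k, 0 < n → r ≤ k → k ≤ 4 * r → h k ≤ B) (w : Fin n → ℤ) :
    IsMaxWeight M₁ M₂ w ((fullAlg acc t n w).output o) ∧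
      ((fullAlg acc t n w).rounds o : ℝ) ≤
        30 * (15 + 2 * K) * B * max 1 (Real.log ((maxAbsWeight w : ℝ) * r)) ∧
      (fullAlg acc t n w).width o ≤ 36 * n ^ 2 := by
  rw [fullAlg]
  split_ifs with hW
  · simp only [ParallelAlg.output_done, ParallelAlg.rounds_done, ParallelAlg.width_done]
    refine ⟨⟨commonIndep_empty, fun T _ => ?_⟩, ?_, Nat.zero_le _⟩
    · refine le_of_eq (Finset.sum_eq_zero fun e _ => ?_)
      have : (w e).natAbs ≤ maxAbsWeight w :=
        Finset.le_sup (f := fun e => (w e).natAbs) (Finset.mem_univ e)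
      omega
    · have := le_max_left 1 (Real.log ((maxAbsWeight w : ℝ) * r))
      push_cast
      positivity
  have hn : 0 < n := by
    rcases Nat.eq_zero_or_pos n with rfl | hn
    · exact absurd (by simp [maxAbsWeight]) hW
    · exact hn
  have hr0 : 0 < r := by omega
  have hrn : r ≤ n := by
    have := commonRank_le (M₁ := M₁) (M₂ := M₂)
    omega
  set Λ := max 1 (Real.log ((maxAbsWeight w : ℝ) * r)) with hΛ
  have hΛ1 : 1 ≤ Λ := le_max_left _ _
  have hwidth : ∀ (u : Fin n → ℤ) k, 0 < k → k ≤ 2 * r → (solver acc t n u k).width o ≤ 36 * n ^ 2 :=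
    fun u k hk hkr => (solveBounded_width (hacc k hk) _ _ _ u).trans (by
      have : n + k ≤ 3 * n := by omega
      calc 4 * (n + k) ^ 2 ≤ 4 * (3 * n) ^ 2 := by gcongr
        _ = 36 * n ^ 2 := by ring)
  have hrounds : ∀ (u : Fin n → ℤ) k, 0 < k → k ≤ 2 * r → maxAbsWeight u ≤ maxAbsWeight w →
      ((solver acc t n u k).rounds o : ℝ) ≤ 5 * Λ * (15 + 2 * K) * h k := by
    intro u k hk hkr hu
    obtain ⟨ht1, ht2⟩ := ht k hk (by omega)
    obtain ⟨hh1, hh2, -⟩ := hh k hk (by omega)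
    have h1 : ((solver acc t n u k).rounds o : ℝ) ≤ _ :=
      Nat.cast_le.2 (solveBounded_rounds (hacc k hk) _ _ _ u)
    rw [Nat.cast_mul] at h1
    refine h1.trans ?_
    calc _ ≤ (5 * Λ) * ((15 + 2 * K) * h k) :=
          mul_le_mul (phaseLog_le hu (Nat.pos_of_ne_zero hW) hr0 hkr)
            (phaseLength_le hk ht1 hK hh1 ht2 hh2) (Nat.cast_nonneg _) (by positivity)
      _ = _ := by ring
  have hone : maxAbsWeight (fun _ : Fin n => (1 : ℤ)) ≤ maxAbsWeight w :=
    (Finset.sup_le fun _ _ => by simp : _ ≤ 1).trans (Nat.one_le_iff_ne_zero.2 hW)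
  have hcard : ∀ k, 0 < k → k ≤ 2 * r →
      ((solver acc t n (fun _ => 1) k).output o).card = min k (commonRank M₁ M₂) := by
    intro k hk _
    obtain ⟨h1, h2, h3⟩ := solveBounded_output (hacc k hk) (phaseParams n (t n k) hk) (fun _ => 1)
      (S := (solver acc t n (fun _ => 1) k).output o) rfl
    obtain ⟨T, hT, hTc⟩ := exists_card_eq_commonRank M₁ M₂
    obtain ⟨T', hT', hTc'⟩ := Finset.exists_subset_card_eq
      (s := T) (n := min k (commonRank M₁ M₂)) (by omega)
    have h4 := h3 T' (hT.subset hT') (by omega)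
    simp only [Finset.sum_const, nsmul_eq_mul, mul_one, Nat.cast_le] at h4
    have := h1.card_le
    omega
  rw [hr] at hwidth hrounds hcard
  obtain ⟨h1, h2, h3, h4⟩ := doubling_spec (o := o) (solver := solver acc t n fun _ => 1)
    (r₀ := commonRank M₁ M₂) (c := 36 * n ^ 2) (β := fun k => 5 * Λ * (15 + 2 * K) * h k)
    hcard (fun k hk hkr => hrounds _ k hk hkr hone) (fun k hk hkr => hwidth _ k hk hkr)
    (fun k hk hkr => by
      obtain ⟨hh1, -, hh3⟩ := hh k hk (by omega)
      refine ⟨by positivity, ?_⟩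
      calc 6 / 5 * (5 * Λ * (15 + 2 * K) * h k) = 5 * Λ * (15 + 2 * K) * (6 / 5 * h k) := by ring
        _ ≤ _ := by gcongr) n 1 one_pos (by omega)
    (by rw [mul_one]; exact (commonRank_le).trans_lt Nat.lt_two_pow_self)
  simp only [ParallelAlg.output_bind, ParallelAlg.rounds_bind, ParallelAlg.width_bind]
  set k := (doubling (solver acc t n fun _ => 1) n 1).output o
  have hk : 0 < k := by omega
  obtain ⟨h5, h6, h7⟩ := solveBounded_output (hacc k hk) (phaseParams n (t n k) hk) w
    (S := (solver acc t n w k).output o) rfl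
  refine ⟨⟨h5, fun T hT => h7 T hT (hT.card_le.trans h1.le)⟩, ?_, max_le h4 (hwidth w k hk h2)⟩
  have h8 := hrounds w k hk h2 le_rfl
  have h9 : h k ≤ B := hB' k hn (by omega) (by omega)
  have h10 : h (2 * k) ≤ B := hB' (2 * k) hn (by omega) (by omega)
  have h11 := (hh 1 one_pos (by omega)).1
  have hc : 0 ≤ 5 * Λ * (15 + 2 * K) := by positivity
  have h12 := mul_le_mul_of_nonneg_left h9 hc
  have h13 := mul_le_mul_of_nonneg_left h10 hc
  have h14 := mul_nonneg hc h11
  push_cast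
  calc _ ≤ 5 * (5 * Λ * (15 + 2 * K) * h (2 * k) - 5 * Λ * (15 + 2 * K) * h 1) +
        5 * Λ * (15 + 2 * K) * h k := add_le_add h3 h8
    _ ≤ 5 * (5 * Λ * (15 + 2 * K) * B) + 5 * Λ * (15 + 2 * K) * B := by linarith
    _ = _ := by ring

end Main

/-! ### Numerical bounds -/

section Bounds

lemma rpow_third_pow {x : ℝ} (hx : 0 ≤ x) : (x ^ (1 / 3 : ℝ)) ^ 3 = x := by
  rw [← Real.rpow_natCast, ← Real.rpow_mul hx]
  norm_num

lemma six_fifths_le_two_rpow : (6 / 5 : ℝ) ≤ 2 ^ (1 / 3 : ℝ) := by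
  refine le_of_pow_le_pow_left₀ three_ne_zero (by positivity) ?_
  rw [rpow_third_pow (by norm_num)]
  norm_num

lemma basisRounds_le {N k : ℕ} (hk : 0 < k) (hkN : k ≤ N) :
    (basisRounds N k : ℝ) ≤ √k * (12 + 2 * Real.log (N / k)) := by
  have hk1 : (1 : ℝ) ≤ k := by exact_mod_cast hk
  have hx : 0 ≤ Real.log (N / k) := by
    apply Real.log_nonneg
    rw [le_div_iff₀ (by linarith), one_mul]
    exact_mod_cast hkN
  have hs : (Nat.sqrt k : ℝ) ≤ √k := Real.nat_sqrt_le_real_sqrt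
  have h1 : 1 ≤ √(k : ℝ) := Real.one_le_sqrt.2 hk1
  have h2 : √(2 * k : ℝ) ≤ 3 / 2 * √k := by
    rw [Real.sqrt_mul (by norm_num)]
    gcongr
    rw [Real.sqrt_le_left (by norm_num)]
    norm_num
  have h3 := Nat.floor_le (a := 4 * √(2 * k : ℝ)) (by positivity)
  have h4 := Nat.floor_le (a := 3 * (Nat.sqrt k : ℝ) + 2 * Nat.sqrt k * Real.log (N / k))
    (by positivity)
  have h5 := mul_le_mul_of_nonneg_right hs hx
  simp only [basisRounds]
  push_cast
  nlinarith

/-- The bound for the number of rounds of independence queries in a phase of rank `k`. -/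
noncomputable def indepBound (n k : ℕ) : ℝ :=
  2 * ((n : ℝ) ^ (1 / 3 : ℝ) * √k * (12 + Real.log (3 * n / k)))

/-- The numerator `3 * n` covers `n + k` for every `k ≤ 2 * n` that doubling can reach. -/
lemma indepBound_spec {n k : ℕ} (hn : 0 < n) (hk : 0 < k) (hkn : k ≤ 2 * n) :
    0 ≤ indepBound n k ∧
      ((n : ℝ) + k) * k * basisRounds (n + k) k ≤ indepBound n k ^ 3 ∧
      6 / 5 * indepBound n k ≤ indepBound n (2 * k) := by
  have hnR : (0 : ℝ) < n := by exact_mod_cast hn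
  have hkR : (0 : ℝ) < k := by exact_mod_cast hk
  have hknR : (k : ℝ) ≤ 2 * n := by exact_mod_cast hkn
  have hx : 0 ≤ Real.log (3 * n / k) := by
    apply Real.log_nonneg
    rw [le_div_iff₀ hkR]
    linarith
  have hle : Real.log ((n + k) / k) ≤ Real.log (3 * n / k) :=
    Real.log_le_log (by positivity) (by gcongr; linarith)
  set x := Real.log (3 * n / k) with hxdef
  refine ⟨by unfold indepBound; positivity, ?_, ?_⟩
  · have h1 := basisRounds_le hk (by omega : k ≤ n + k)
    push_cast at h1
    have h2 : (basisRounds (n + k) k : ℝ) ≤ √k * (2 * (12 + x)) :=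
      h1.trans (by gcongr; linarith)
    -- A single factor `12 + x` would suffice; two more are given away to obtain a perfect cube.
    have h3 : (1 : ℝ) ≤ (12 + x) ^ 2 := by nlinarith
    calc ((n : ℝ) + k) * k * basisRounds (n + k) k
        ≤ (3 * n) * k * (√k * (2 * (12 + x))) := by gcongr; linarith
      _ = 6 * (n * k * √k * (12 + x)) * 1 := by ring
      _ ≤ 8 * (n * k * √k * (12 + x)) * (12 + x) ^ 2 := by gcongr; norm_num
      _ = 8 * ((n : ℝ) ^ (1 / 3 : ℝ)) ^ 3 * (√k ^ 2) * √k * (12 + x) ^ 3 := by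
          rw [rpow_third_pow hnR.le, Real.sq_sqrt hkR.le]; ring
      _ = indepBound n k ^ 3 := by rw [indepBound]; ring
  · have h1 : Real.log (3 * n / (2 * k : ℕ)) = x - Real.log 2 := by
      rw [hxdef, ← Real.log_div (by positivity) (by norm_num)]
      congr 1
      push_cast
      field_simp
    have h2 : (7 / 5 : ℝ) * √k ≤ √((2 * k : ℕ) : ℝ) := by
      rw [Nat.cast_mul, Nat.cast_ofNat, Real.sqrt_mul (by norm_num)]
      gcongr
      exact Real.le_sqrt_of_sq_le (by norm_num)
    have h3 := Real.log_two_lt_d9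
    -- Doubling `k` gains `√2 ≥ 7 / 5` and loses `Real.log 2` in the logarithm; the offset `12`
    -- keeps the net growth above `6 / 5`.
    have h4 : 6 / 5 * (12 + x) ≤ 7 / 5 * (12 + (x - Real.log 2)) := by linarith
    rw [indepBound, indepBound, h1]
    calc 6 / 5 * (2 * ((n : ℝ) ^ (1 / 3 : ℝ) * √k * (12 + x)))
        = 2 * ((n : ℝ) ^ (1 / 3 : ℝ) * √k * (6 / 5 * (12 + x))) := by ring
      _ ≤ 2 * ((n : ℝ) ^ (1 / 3 : ℝ) * √k * (7 / 5 * (12 + (x - Real.log 2)))) := by gcongr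
      _ = 2 * ((n : ℝ) ^ (1 / 3 : ℝ) * (7 / 5 * √k) * (12 + (x - Real.log 2))) := by ring
      _ ≤ _ := by
        gcongr
        linarith

lemma indepBound_le {n k r : ℕ} (hn : 0 < n) (hr : 0 < r) (hrk : r ≤ k) (hkr : k ≤ 4 * r)
    (hrn : r ≤ n) : indepBound n k ≤
      60 * ((n : ℝ) ^ (1 / 3 : ℝ) * (r : ℝ) ^ (1 / 2 : ℝ) * max 1 (Real.log (n / r))) := by
  have hnR : (0 : ℝ) < n := by exact_mod_cast hn
  have hrR : (0 : ℝ) < r := by exact_mod_cast hr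
  have hrkR : (r : ℝ) ≤ k := by exact_mod_cast hrk
  have hkrR : (k : ℝ) ≤ 4 * r := by exact_mod_cast hkr
  have hrnR : (r : ℝ) ≤ n := by exact_mod_cast hrn
  have hkR : (0 : ℝ) < k := hrR.trans_le hrkR
  have h1 : Real.log (3 * n / k) ≤ 2 + Real.log (n / r) := by
    have h2 : Real.log (3 * n / k) ≤ Real.log (3 * (n / r)) :=
      Real.log_le_log (by positivity) (by rw [← mul_div_assoc]; gcongr)
    rw [Real.log_mul (by norm_num) (by positivity)] at h2
    have := Real.log_le_sub_one_of_pos (show (0 : ℝ) < 3 by norm_num)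
    linarith
  have h3 : √(k : ℝ) ≤ 2 * √r := by
    have : √(k : ℝ) ≤ √(2 ^ 2 * r) := Real.sqrt_le_sqrt (by linarith)
    rwa [Real.sqrt_mul (by norm_num), Real.sqrt_sq (by norm_num)] at this
  have h4 : 12 + Real.log (3 * n / k) ≤ 15 * max 1 (Real.log (n / r)) := by
    have := le_max_left 1 (Real.log ((n : ℝ) / r))
    have := le_max_right 1 (Real.log ((n : ℝ) / r))
    linarith
  rw [indepBound, ← Real.sqrt_eq_rpow]
  have hM : 0 ≤ max 1 (Real.log ((n : ℝ) / r)) := zero_le_one.trans (le_max_left _ _)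
  calc 2 * ((n : ℝ) ^ (1 / 3 : ℝ) * √k * (12 + Real.log (3 * n / k)))
      ≤ 2 * ((n : ℝ) ^ (1 / 3 : ℝ) * √k * (15 * max 1 (Real.log (n / r)))) := by gcongr
    _ ≤ 2 * ((n : ℝ) ^ (1 / 3 : ℝ) * (2 * √r) * (15 * max 1 (Real.log (n / r)))) := by gcongr
    _ = _ := by ring

/-- With `x = Real.log ((n + k) / k)`, the quadratic lower bound for `exp x` gives `(12 + 2 * x) ^ 2
≤ 144 * exp x`. This makes `K = 6` admissible. -/
lemma basisRounds_sq_le (n : ℕ) {k : ℕ} (hk : 0 < k) :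
    (basisRounds (n + k) k : ℝ) ^ 2 ≤ 6 ^ 3 * (n + k) * k := by
  have hkR : (0 : ℝ) < k := by exact_mod_cast hk
  have hk1 : (1 : ℝ) ≤ k := by exact_mod_cast hk
  have h1 := basisRounds_le hk (by omega : k ≤ n + k)
  push_cast at h1
  have hx : 0 ≤ Real.log ((n + k) / k) := by
    apply Real.log_nonneg
    rw [le_div_iff₀ hkR]
    linarith [Nat.cast_nonneg (α := ℝ) n]
  have hexp : Real.exp (Real.log ((n + k) / k)) = (n + k) / k := Real.exp_log (by positivity)
  set x := Real.log ((n + k) / k)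
  have h2 := Real.quadratic_le_exp_of_nonneg hx
  rw [hexp] at h2
  calc (basisRounds (n + k) k : ℝ) ^ 2 ≤ (√k * (12 + 2 * x)) ^ 2 := by gcongr
    _ = k * (12 + 2 * x) ^ 2 := by rw [mul_pow, Real.sq_sqrt hkR.le]
    _ ≤ k * (144 * ((n + k) / k)) := by gcongr; nlinarith
    _ = 144 * (n + k) * 1 := by field_simp
    _ ≤ 6 ^ 3 * (n + k) * k := by gcongr; norm_num

end Bounds

end MatroidIntersection

theorem theorem1p4 :
    ∃ (C : ℝ) (c d : ℕ),
      (∃ alg : (n : ℕ) → (Fin n → ℤ) → MatroidIntersection.RankAlg n,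
        ∀ (n : ℕ) (w : Fin n → ℤ) (M₁ M₂ : Matroid (Fin n)),
          M₁.E = Set.univ → M₂.E = Set.univ →
          ∀ W r : ℕ, W = MatroidIntersection.maxAbsWeight w →
            r = max 1 (MatroidIntersection.commonRank M₁ M₂) →
            MatroidIntersection.IsMaxWeight M₁ M₂ w
              ((alg n w).output (MatroidIntersection.rankOracle M₁ M₂)) ∧
            ((alg n w).rounds (MatroidIntersection.rankOracle M₁ M₂) : ℝ) ≤
              C * (n : ℝ) ^ (1 / 3 : ℝ) * (r : ℝ) ^ (1 / 3 : ℝ) *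
                max 1 (Real.log ((W : ℝ) * (r : ℝ))) ∧
            (alg n w).width (MatroidIntersection.rankOracle M₁ M₂) ≤ c * n ^ d) ∧
      (∃ alg : (n : ℕ) → (Fin n → ℤ) → MatroidIntersection.IndepAlg n,
        ∀ (n : ℕ) (w : Fin n → ℤ) (M₁ M₂ : Matroid (Fin n)),
          M₁.E = Set.univ → M₂.E = Set.univ →
          ∀ W r : ℕ, W = MatroidIntersection.maxAbsWeight w →
            r = max 1 (MatroidIntersection.commonRank M₁ M₂) →
            MatroidIntersection.IsMaxWeight M₁ M₂ w
              ((alg n w).output (MatroidIntersection.indepOracle M₁ M₂)) ∧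
            ((alg n w).rounds (MatroidIntersection.indepOracle M₁ M₂) : ℝ) ≤
              C * (n : ℝ) ^ (1 / 3 : ℝ) * (r : ℝ) ^ (1 / 2 : ℝ) *
                max 1 (Real.log ((W : ℝ) * (r : ℝ))) *
                max 1 (Real.log ((n : ℝ) / (r : ℝ))) ∧
            (alg n w).width (MatroidIntersection.indepOracle M₁ M₂) ≤ c * n ^ d) := by
  open MatroidIntersection in
  refine ⟨30 * (15 + 2 * 6) * 60, 36, 2, ⟨fullAlg rankAccess fun _ _ => 1, ?_⟩,
    ⟨fullAlg indepAccess fun n k => basisRounds (n + k) k, ?_⟩⟩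
  · rintro n w M₁ M₂ hE₁ hE₂ W r rfl hr
    have hr0 : 0 < r := by omega
    -- The cube of `h k` is `8 * n * k`, which exceeds `(n + k) * k` since `k ≤ 2 * n`; doubling `k`
    -- multiplies `h k` by `2 ^ (1 / 3) ≥ 6 / 5`.
    obtain ⟨h1, h2, h3⟩ := fullAlg_spec (acc := rankAccess) (t := fun _ _ => 1) (w := w)
      (h := fun k => 2 * ((n : ℝ) ^ (1 / 3 : ℝ) * (k : ℝ) ^ (1 / 3 : ℝ))) (K := 6)
      (B := 60 * ((n : ℝ) ^ (1 / 3 : ℝ) * (r : ℝ) ^ (1 / 3 : ℝ)))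
      (fun k _ => rankAccess_correct hE₁ hE₂) (by norm_num)
      (fun k hk _ => ⟨one_pos, by
        have hk1 : (1 : ℝ) ≤ k := by exact_mod_cast hk
        have := Nat.cast_nonneg (α := ℝ) n
        push_cast
        nlinarith⟩)
      (fun k hk hkn => ⟨by positivity, by
        have hknR : (k : ℝ) ≤ 2 * n := by exact_mod_cast hkn
        rw [mul_pow, mul_pow, rpow_third_pow (by positivity), rpow_third_pow (by positivity)]
        push_cast
        nlinarith [Nat.cast_nonneg (α := ℝ) k], by
        have h2 := six_fifths_le_two_rpow
        rw [Nat.cast_mul, Real.mul_rpow (by norm_num) (by positivity)]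
        push_cast
        calc 6 / 5 * (2 * ((n : ℝ) ^ (1 / 3 : ℝ) * (k : ℝ) ^ (1 / 3 : ℝ)))
            = 2 * ((n : ℝ) ^ (1 / 3 : ℝ) * (6 / 5 * (k : ℝ) ^ (1 / 3 : ℝ))) := by ring
          _ ≤ _ := by gcongr⟩) hr (by positivity) (fun k _ _ hkr => by
        have h1 : (k : ℝ) ^ (1 / 3 : ℝ) ≤ 2 * (r : ℝ) ^ (1 / 3 : ℝ) := by
          refine le_of_pow_le_pow_left₀ three_ne_zero (by positivity) ?_
          rw [mul_pow, rpow_third_pow (by positivity), rpow_third_pow (by positivity)]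
          have : (k : ℝ) ≤ 4 * r := by exact_mod_cast hkr
          linarith [Nat.cast_nonneg (α := ℝ) r]
        calc 2 * ((n : ℝ) ^ (1 / 3 : ℝ) * (k : ℝ) ^ (1 / 3 : ℝ))
            ≤ 2 * ((n : ℝ) ^ (1 / 3 : ℝ) * (2 * (r : ℝ) ^ (1 / 3 : ℝ))) := by gcongr
          _ = 4 * ((n : ℝ) ^ (1 / 3 : ℝ) * (r : ℝ) ^ (1 / 3 : ℝ)) := by ring
          _ ≤ _ := by gcongr; norm_num)
    exact ⟨h1, h2.trans (le_of_eq (by ring)), h3⟩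
  · rintro n w M₁ M₂ hE₁ hE₂ W r rfl hr
    have hr0 : 0 < r := by omega
    obtain ⟨h1, h2, h3⟩ := fullAlg_spec (acc := indepAccess)
      (t := fun n k => basisRounds (n + k) k) (w := w) (h := indepBound n) (K := 6)
      (B := 60 * ((n : ℝ) ^ (1 / 3 : ℝ) * (r : ℝ) ^ (1 / 2 : ℝ) * max 1 (Real.log (n / r))))
      (fun k hk => indepAccess_correct hk) (by norm_num)
      (fun k hk _ => ⟨by unfold basisRounds; omega, basisRounds_sq_le n hk⟩)
      (fun k hk hkn => indepBound_spec (by omega) hk hkn) hr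
      (mul_nonneg (by norm_num) (mul_nonneg (by positivity)
        (zero_le_one.trans (le_max_left _ _))))
      (fun k hn hrk hkr => indepBound_le hn hr0 hrk hkr (by
        have := commonRank_le (M₁ := M₁) (M₂ := M₂)
        omega))
    exact ⟨h1, h2.trans (le_of_eq (by ring)), h3⟩
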